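/- Let $k$ be an algebraically closed field of characteristic $0$. A fusion category over $k$ is a $k$-linear semisimple abelian rigid monoidal category with $k$-bilinear tensor product, finitely many isomorphism classes of simple objects, finite-dimensional $\mathrm{Hom}$-spaces and a simple unit object. A fusion subcategory of such a category is a full tensor subcategory, that is, a full (replete) subcategory containing the unit object and closed under tensor products, finite direct sums, subobjects, quotients and duals. For a fusion category $\mathcal{E}$ let $\mathcal{O}(\mathcal{E})$ be the set of isomorphism classes of its simple objects. A grading of $\mathcal{E}$ by a finite group $G$ is a map $\deg:\mathcal{O}(\mathcal{E})\to G$ such that $\deg Z=\deg X\cdot\deg Y$ for all simple objects $X,Y,Z$ such that $X\otimes Y$ contains $Z$; it is faithful if $\deg$ is surjective; and $\mathcal{E}_g\subset\mathcal{E}$ denotes the full additive subcategory generated by the simple objects of degree $g$. Let $\mathcal{C}$ and $\mathcal{D}$ be fusion categories over $k$, and let $\mathcal{C}\boxtimes\mathcal{D}$ be their Deligne tensor product. A subcategory datum $(\mathcal{E},\mathcal{F},G)$ for $\mathcal{C}\boxtimes\mathcal{D}$ consists of fusion subcategories $\mathcal{E}\subset\mathcal{C}$ and $\mathcal{F}\subset\mathcal{D}$,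 a finite group $G$, and fixed faithful gradings of $\mathcal{E}$ and of $\mathcal{F}$ by $G$. Data $(\mathcal{E},\mathcal{F},G)$ and $(\mathcal{E},\mathcal{F},G')$ are identified if there is a group isomorphism $\alpha:G\to G'$ such that $\mathcal{E}_g=\mathcal{E}_{\alpha(g)}$ and $\mathcal{F}_g=\mathcal{F}_{\alpha(g)}$ for all $g\in G$. The fiber product of a datum is the full subcategory $$\mathcal{E}\boxtimes_G\mathcal{F}=\bigoplus_{g\in G}\mathcal{E}_g\boxtimes\mathcal{F}_g\subset\mathcal{C}\boxtimes\mathcal{D}.$$ Theorem. For every subcategory datum, $\mathcal{E}\boxtimes_G\mathcal{F}$ is a fusion subcategory of $\mathcal{C}\boxtimes\mathcal{D}$, and the assignment $(\mathcal{E},\mathcal{F},G)\mapsto\mathcal{E}\boxtimes_G\mathcal{F}$ is a bijection between the set of subcategory data for $\mathcal{C}\boxtimes\mathcal{D}$, up to the above identification, and the set of fusion subcategories of $\mathcal{C}\boxtimes\mathcal{D}$. -/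

import Mathlib

open CategoryTheory CategoryTheory.Limits CategoryTheory.MonoidalCategory

universe w v₁ v₂ u₁ u₂ t

noncomputable section

namespace Fusion

/-! ### The `k`-linear tensor product of two `k`-linear categories -/

section LinTensor

variable (k : Type w) [Field k] {C : Type u₁} [Category.{v₁} C] [Preadditive C] [Linear k C]
  {D : Type u₂} [Category.{v₂} D] [Preadditive D] [Linear k D]

/-- The `k`-linear tensor product `C ⊗ D` of two `k`-linear categories: its objects are pairs
`(X, Y)`, and `Hom((X, Y), (X', Y')) = Hom(X, X') ⊗_k Hom(Y, Y')`. -/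
structure LinTensor (k : Type w) (C : Type u₁) (D : Type u₂) where
  /-- the object of `C` -/
  fst : C
  /-- the object of `D` -/
  snd : D

namespace LinTensor

variable {k}

/-- The space of morphisms `Hom(X, X') ⊗_k Hom(Y, Y')`. -/
def Hom (X Y : LinTensor k C D) : Type (max v₁ v₂) :=
  TensorProduct k (X.fst ⟶ Y.fst) (X.snd ⟶ Y.snd)

instance instAddCommGroup (X Y : LinTensor k C D) : AddCommGroup (Hom X Y) :=
  inferInstanceAs (AddCommGroup (TensorProduct k (X.fst ⟶ Y.fst) (X.snd ⟶ Y.snd)))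

instance instModule (X Y : LinTensor k C D) : Module k (Hom X Y) :=
  inferInstanceAs (Module k (TensorProduct k (X.fst ⟶ Y.fst) (X.snd ⟶ Y.snd)))

/-- The pure tensor `f ⊗ g`. -/
def pure {X Y : LinTensor k C D} (f : X.fst ⟶ Y.fst) (g : X.snd ⟶ Y.snd) : Hom X Y :=
  TensorProduct.tmul k f g

theorem pure_induction {X Y : LinTensor k C D} {p : Hom X Y → Prop} (f : Hom X Y)
    (zero : p 0) (tmul : ∀ a b, p (pure a b)) (add : ∀ a b, p a → p b → p (a + b)) : p f :=
  TensorProduct.induction_on (motive := p) f zero tmul add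

/-- Composition, the bilinear map with `(f ⊗ g) ≫ (f' ⊗ g') = (f ≫ f') ⊗ (g ≫ g')`. -/
def compBilin (X Y Z : LinTensor k C D) : Hom X Y →ₗ[k] Hom Y Z →ₗ[k] Hom X Z :=
  TensorProduct.map₂ (Linear.comp (S := k) X.fst Y.fst Z.fst)
    (Linear.comp (S := k) X.snd Y.snd Z.snd)

theorem compBilin_pure {X Y Z : LinTensor k C D} (f : X.fst ⟶ Y.fst) (g : X.snd ⟶ Y.snd)
    (f' : Y.fst ⟶ Z.fst) (g' : Y.snd ⟶ Z.snd) :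
    compBilin X Y Z (pure f g) (pure f' g') = pure (f ≫ f') (g ≫ g') := by
  have h := TensorProduct.map₂_apply_tmul (Linear.comp (S := k) X.fst Y.fst Z.fst)
    (Linear.comp (S := k) X.snd Y.snd Z.snd) f g
  exact (LinearMap.congr_fun h (TensorProduct.tmul k f' g')).trans (TensorProduct.map_tmul ..)

instance instCategory : Category.{max v₁ v₂} (LinTensor k C D) where
  Hom X Y := Hom X Y
  id X := pure (𝟙 X.fst) (𝟙 X.snd)
  comp {X Y Z} f g := compBilin X Y Z f g
  id_comp f := by
    induction f using pure_induction with
    | zero => exact map_zero _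
    | tmul a b => rw [compBilin_pure, Category.id_comp, Category.id_comp]
    | add a b ha hb => rw [map_add, ha, hb]
  comp_id f := by
    induction f using pure_induction with
    | zero => exact LinearMap.map_zero₂ _ _
    | tmul a b => rw [compBilin_pure, Category.comp_id, Category.comp_id]
    | add a b ha hb => rw [LinearMap.map_add₂, ha, hb]
  assoc f g h := by
    induction f using pure_induction with
    | zero => rw [LinearMap.map_zero₂, LinearMap.map_zero₂, LinearMap.map_zero₂]
    | add a b ha hb =>
      rw [LinearMap.map_add₂, LinearMap.map_add₂, LinearMap.map_add₂, ha, hb]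
    | tmul a b =>
      induction g using pure_induction with
      | zero => rw [map_zero, LinearMap.map_zero₂, LinearMap.map_zero₂, map_zero]
      | add a b ha hb =>
        rw [map_add, LinearMap.map_add₂, LinearMap.map_add₂, map_add, ha, hb]
      | tmul c d =>
        induction h using pure_induction with
        | zero => rw [map_zero, map_zero, map_zero]
        | add a b ha hb => rw [map_add, map_add, map_add, ha, hb]
        | tmul e f =>
          rw [compBilin_pure, compBilin_pure, compBilin_pure, compBilin_pure,
            Category.assoc, Category.assoc]

instance instAddCommGroupHom (X Y : LinTensor k C D) : AddCommGroup (X ⟶ Y) :=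
  inferInstanceAs (AddCommGroup (Hom X Y))

instance instModuleHom (X Y : LinTensor k C D) : Module k (X ⟶ Y) :=
  inferInstanceAs (Module k (Hom X Y))

instance instPreadditive : Preadditive (LinTensor k C D) where
  homGroup X Y := instAddCommGroupHom X Y
  add_comp X Y Z f f' g := LinearMap.map_add₂ (compBilin X Y Z) f f' g
  comp_add X Y Z f g g' := LinearMap.map_add (compBilin X Y Z f) g g'

instance instLinear : Linear k (LinTensor k C D) where
  homModule X Y := instModuleHom X Y
  smul_comp X Y Z r f g := LinearMap.map_smul₂ (compBilin X Y Z) r f g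
  comp_smul X Y Z f r g := LinearMap.map_smul (compBilin X Y Z f) r g

/-- The pure tensor `f ⊗ g`, as a morphism `(X, Y) ⟶ (X', Y')`. -/
def tmul {X Y : LinTensor k C D} (f : X.fst ⟶ Y.fst) (g : X.snd ⟶ Y.snd) : X ⟶ Y :=
  pure f g

theorem hom_induction {X Y : LinTensor k C D} {p : (X ⟶ Y) → Prop} (f : X ⟶ Y)
    (zero : p 0) (tmul : ∀ a b, p (tmul a b)) (add : ∀ a b, p a → p b → p (a + b)) : p f :=
  pure_induction (p := p) f zero tmul add

theorem one_eq (X : LinTensor k C D) : 𝟙 X = tmul (𝟙 X.fst) (𝟙 X.snd) := rfl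

theorem tmul_comp_tmul {X Y Z : LinTensor k C D} (f : X.fst ⟶ Y.fst) (g : X.snd ⟶ Y.snd)
    (f' : Y.fst ⟶ Z.fst) (g' : Y.snd ⟶ Z.snd) :
    (tmul f g : X ⟶ Y) ≫ (tmul f' g' : Y ⟶ Z) = tmul (f ≫ f') (g ≫ g') :=
  compBilin_pure f g f' g'

/-- A pair of isomorphisms gives an isomorphism. -/
def mkIso {X Y : LinTensor k C D} (e : X.fst ≅ Y.fst) (e' : X.snd ≅ Y.snd) : X ≅ Y where
  hom := tmul e.hom e'.hom
  inv := tmul e.inv e'.inv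
  hom_inv_id := by rw [tmul_comp_tmul, one_eq, e.hom_inv_id, e'.hom_inv_id]
  inv_hom_id := by rw [tmul_comp_tmul, one_eq, e.inv_hom_id, e'.inv_hom_id]

variable [MonoidalCategory C] [MonoidalPreadditive C] [MonoidalLinear k C]
  [MonoidalCategory D] [MonoidalPreadditive D] [MonoidalLinear k D]

variable (k) in
/-- The tensor product of morphisms of a `k`-linear monoidal category, as a bilinear map. -/
def tensorBilin {B : Type*} [Category* B] [Preadditive B] [Linear k B] [MonoidalCategory B]
    [MonoidalPreadditive B] [MonoidalLinear k B] (X Y X' Y' : B) :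
    (X ⟶ Y) →ₗ[k] (X' ⟶ Y') →ₗ[k] (X ⊗ X' ⟶ Y ⊗ Y') :=
  LinearMap.mk₂ k (fun f g => f ⊗ₘ g) (fun _ _ _ => MonoidalPreadditive.add_tensor _ _ _)
    (fun _ _ _ => by simp [MonoidalCategory.tensorHom_def])
    (fun _ _ _ => MonoidalPreadditive.tensor_add _ _ _)
    (fun _ _ _ => by simp [MonoidalCategory.tensorHom_def])

/-- The tensor product of objects, `(X, Y) ⊗ (X', Y') = (X ⊗ X', Y ⊗ Y')`. -/
def tensorPair (X X' : LinTensor k C D) : LinTensor k C D :=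
  ⟨X.fst ⊗ X'.fst, X.snd ⊗ X'.snd⟩

/-- The tensor product of morphisms, the bilinear map that sends a pair of pure tensors
`f ⊗ g`, `f' ⊗ g'` to the pure tensor of `f ⊗ f'` and `g ⊗ g'`. -/
def tensorHomBilin (X Y X' Y' : LinTensor k C D) :
    (X ⟶ Y) →ₗ[k] (X' ⟶ Y') →ₗ[k] (tensorPair X X' ⟶ tensorPair Y Y') :=
  TensorProduct.map₂ (tensorBilin k X.fst Y.fst X'.fst Y'.fst)
    (tensorBilin k X.snd Y.snd X'.snd Y'.snd)

theorem tensorHomBilin_tmul {X Y X' Y' : LinTensor k C D} (f : X.fst ⟶ Y.fst)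
    (g : X.snd ⟶ Y.snd) (f' : X'.fst ⟶ Y'.fst) (g' : X'.snd ⟶ Y'.snd) :
    tensorHomBilin X Y X' Y' (tmul f g) (tmul f' g') =
      (tmul (X := tensorPair X X') (Y := tensorPair Y Y') (f ⊗ₘ f') (g ⊗ₘ g')) := by
  have h := TensorProduct.map₂_apply_tmul (tensorBilin k X.fst Y.fst X'.fst Y'.fst)
    (tensorBilin k X.snd Y.snd X'.snd Y'.snd) f g
  exact (LinearMap.congr_fun h (TensorProduct.tmul k f' g')).trans (TensorProduct.map_tmul ..)

instance instMonoidalStruct : MonoidalCategoryStruct (LinTensor k C D) where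
  tensorObj X Y := tensorPair X Y
  tensorHom f g := tensorHomBilin _ _ _ _ f g
  whiskerLeft X _ _ f := tensorHomBilin _ _ _ _ (𝟙 X) f
  whiskerRight f Y := tensorHomBilin _ _ _ _ f (𝟙 Y)
  tensorUnit := ⟨𝟙_ C, 𝟙_ D⟩
  associator X Y Z := mkIso (α_ X.fst Y.fst Z.fst) (α_ X.snd Y.snd Z.snd)
  leftUnitor X := mkIso (λ_ X.fst) (λ_ X.snd)
  rightUnitor X := mkIso (ρ_ X.fst) (ρ_ X.snd)

theorem tmul_tensor_tmul {X Y X' Y' : LinTensor k C D} (f : X.fst ⟶ Y.fst) (g : X.snd ⟶ Y.snd)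
    (f' : X'.fst ⟶ Y'.fst) (g' : X'.snd ⟶ Y'.snd) :
    (tmul f g : X ⟶ Y) ⊗ₘ (tmul f' g' : X' ⟶ Y') =
      (tmul (X := X ⊗ X') (Y := Y ⊗ Y') (f ⊗ₘ f') (g ⊗ₘ g')) :=
  tensorHomBilin_tmul f g f' g'

theorem add_tensor {X Y X' Y' : LinTensor k C D} (f f' : X ⟶ Y) (g : X' ⟶ Y') :
    (f + f') ⊗ₘ g = f ⊗ₘ g + f' ⊗ₘ g :=
  LinearMap.map_add₂ (tensorHomBilin _ _ _ _) f f' g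

theorem tensor_add {X Y X' Y' : LinTensor k C D} (f : X ⟶ Y) (g g' : X' ⟶ Y') :
    f ⊗ₘ (g + g') = f ⊗ₘ g + f ⊗ₘ g' :=
  map_add (tensorHomBilin _ _ _ _ f) g g'

theorem zero_tensor {X Y X' Y' : LinTensor k C D} (g : X' ⟶ Y') :
    (0 : X ⟶ Y) ⊗ₘ g = 0 :=
  LinearMap.map_zero₂ (tensorHomBilin _ _ _ _) g

theorem tensor_zero {X Y X' Y' : LinTensor k C D} (f : X ⟶ Y) :
    f ⊗ₘ (0 : X' ⟶ Y') = 0 :=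
  map_zero (tensorHomBilin _ _ _ _ f)

theorem tensor_comp_aux {X₁ Y₁ Z₁ X₂ Y₂ Z₂ : LinTensor k C D} (f₁ : X₁ ⟶ Y₁) (f₂ : X₂ ⟶ Y₂)
    (g₁ : Y₁ ⟶ Z₁) (g₂ : Y₂ ⟶ Z₂) :
    (f₁ ⊗ₘ f₂) ≫ (g₁ ⊗ₘ g₂) = (f₁ ≫ g₁) ⊗ₘ (f₂ ≫ g₂) := by
  induction f₁ using hom_induction with
  | zero => rw [zero_tensor, zero_comp, zero_comp, zero_tensor]
  | add a b ha hb =>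
    rw [add_tensor, Preadditive.add_comp, Preadditive.add_comp, add_tensor, ha, hb]
  | tmul a₁ b₁ =>
  induction f₂ using hom_induction with
  | zero => rw [tensor_zero, zero_comp, zero_comp, tensor_zero]
  | add a b ha hb =>
    rw [tensor_add, Preadditive.add_comp, Preadditive.add_comp, tensor_add, ha, hb]
  | tmul a₂ b₂ =>
  induction g₁ using hom_induction with
  | zero => rw [zero_tensor, comp_zero, comp_zero, zero_tensor]
  | add a b ha hb =>
    rw [add_tensor, Preadditive.comp_add, Preadditive.comp_add, add_tensor, ha, hb]
  | tmul a₃ b₃ =>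
  induction g₂ using hom_induction with
  | zero => rw [tensor_zero, comp_zero, comp_zero, tensor_zero]
  | add a b ha hb =>
    rw [tensor_add, Preadditive.comp_add, Preadditive.comp_add, tensor_add, ha, hb]
  | tmul a₄ b₄ =>
    rw [tmul_tensor_tmul, tmul_tensor_tmul, tmul_comp_tmul, tmul_comp_tmul, tmul_tensor_tmul]
    refine (tmul_comp_tmul _ _ _ _).trans ?_
    exact congrArg₂ tmul (tensorHom_comp_tensorHom ..) (tensorHom_comp_tensorHom ..)

theorem associator_naturality_aux {X₁ X₂ X₃ Y₁ Y₂ Y₃ : LinTensor k C D} (f₁ : X₁ ⟶ Y₁)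
    (f₂ : X₂ ⟶ Y₂) (f₃ : X₃ ⟶ Y₃) :
    ((f₁ ⊗ₘ f₂) ⊗ₘ f₃) ≫ (α_ Y₁ Y₂ Y₃).hom = (α_ X₁ X₂ X₃).hom ≫ (f₁ ⊗ₘ (f₂ ⊗ₘ f₃)) := by
  induction f₁ using hom_induction with
  | zero => rw [zero_tensor, zero_tensor, zero_tensor, zero_comp, comp_zero]
  | add a b ha hb =>
    rw [add_tensor, add_tensor, add_tensor, Preadditive.add_comp, Preadditive.comp_add, ha, hb]
  | tmul a₁ b₁ =>
  induction f₂ using hom_induction with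
  | zero => rw [tensor_zero, zero_tensor, zero_tensor, tensor_zero, zero_comp, comp_zero]
  | add a b ha hb =>
    rw [tensor_add, add_tensor, add_tensor, tensor_add, Preadditive.add_comp,
      Preadditive.comp_add, ha, hb]
  | tmul a₂ b₂ =>
  induction f₃ using hom_induction with
  | zero => rw [tensor_zero, tensor_zero, tensor_zero, zero_comp, comp_zero]
  | add a b ha hb =>
    rw [tensor_add, tensor_add, tensor_add, Preadditive.add_comp, Preadditive.comp_add, ha, hb]
  | tmul a₃ b₃ =>
    rw [tmul_tensor_tmul, tmul_tensor_tmul]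
    refine (congrArg (· ≫ (α_ Y₁ Y₂ Y₃).hom) (tmul_tensor_tmul ..)).trans ?_
    refine Eq.trans ?_ (congrArg ((α_ X₁ X₂ X₃).hom ≫ ·) (tmul_tensor_tmul ..)).symm
    refine (tmul_comp_tmul _ _ _ _).trans (Eq.trans ?_ (tmul_comp_tmul _ _ _ _).symm)
    exact congrArg₂ tmul (associator_naturality ..) (associator_naturality ..)

instance instMonoidal : MonoidalCategory (LinTensor k C D) :=
  MonoidalCategory.ofTensorHom
    (id_tensorHom_id := fun X Y => by
      rw [one_eq, one_eq, tmul_tensor_tmul, id_tensorHom_id, id_tensorHom_id]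
      rfl)
    (id_tensorHom := fun _ _ _ _ => rfl)
    (tensorHom_id := fun _ _ => rfl)
    (tensorHom_comp_tensorHom := tensor_comp_aux)
    (associator_naturality := associator_naturality_aux)
    (leftUnitor_naturality := fun {X Y} f => by
      induction f using hom_induction with
      | zero => rw [tensor_zero, zero_comp, comp_zero]
      | add a b ha hb =>
        rw [tensor_add, Preadditive.add_comp, Preadditive.comp_add, ha, hb]
      | tmul a b =>
        rw [one_eq, tmul_tensor_tmul]
        refine (tmul_comp_tmul _ _ _ _).trans (Eq.trans ?_ (tmul_comp_tmul _ _ _ _).symm)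
        rw [id_tensorHom, id_tensorHom]
        exact congrArg₂ tmul (leftUnitor_naturality ..) (leftUnitor_naturality ..))
    (rightUnitor_naturality := fun {X Y} f => by
      induction f using hom_induction with
      | zero => rw [zero_tensor, zero_comp, comp_zero]
      | add a b ha hb =>
        rw [add_tensor, Preadditive.add_comp, Preadditive.comp_add, ha, hb]
      | tmul a b =>
        rw [one_eq, tmul_tensor_tmul]
        refine (tmul_comp_tmul _ _ _ _).trans (Eq.trans ?_ (tmul_comp_tmul _ _ _ _).symm)
        rw [tensorHom_id, tensorHom_id]
        exact congrArg₂ tmul (rightUnitor_naturality ..) (rightUnitor_naturality ..))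
    (pentagon := fun W X Y Z => by
      refine (congrArg₂ (· ≫ ·) (tmul_tensor_tmul ..)
        (congrArg (_ ≫ ·) (tmul_tensor_tmul ..))).trans ?_
      refine (congrArg (_ ≫ ·) (tmul_comp_tmul _ _ _ _)).trans ?_
      refine (tmul_comp_tmul _ _ _ _).trans (Eq.trans ?_ (tmul_comp_tmul _ _ _ _).symm)
      rw [id_tensorHom, id_tensorHom, tensorHom_id, tensorHom_id]
      exact congrArg₂ tmul (MonoidalCategory.pentagon ..) (MonoidalCategory.pentagon ..))
    (triangle := fun X Y => by
      refine (congrArg (_ ≫ ·) (tmul_tensor_tmul ..)).trans ?_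
      refine (tmul_comp_tmul _ _ _ _).trans (Eq.trans ?_ (tmul_tensor_tmul ..).symm)
      rw [id_tensorHom, id_tensorHom, tensorHom_id, tensorHom_id]
      exact congrArg₂ tmul (MonoidalCategory.triangle ..) (MonoidalCategory.triangle ..))

instance instMonoidalPreadditive : MonoidalPreadditive (LinTensor k C D) where
  whiskerLeft_zero := tensor_zero _
  zero_whiskerRight := zero_tensor _
  whiskerLeft_add := tensor_add _
  add_whiskerRight f g := add_tensor f g _

instance instMonoidalLinear : MonoidalLinear k (LinTensor k C D) where
  whiskerLeft_smul X _ _ r f := LinearMap.map_smul (tensorHomBilin _ _ _ _ (𝟙 X)) r f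
  smul_whiskerRight r _ _ f X := LinearMap.map_smul₂ (tensorHomBilin _ _ _ _) r f (𝟙 X)

end LinTensor

end LinTensor

/-! ### The monoidal structure on the additive completion -/

section AdditiveCompletion

variable {A : Type u₁} [Category.{v₁} A] [Preadditive A]

namespace MatTensor

open scoped Classical in
/-- The monomial matrix attached to a bijection `e` of index sets and morphisms `X i ⟶ Y (e i)`. -/
def reindex {M N : Mat_ A} (e : M.ι ≃ N.ι) (f : ∀ i, M.X i ⟶ N.X (e i)) : M ⟶ N :=
  fun i j => if h : e i = j then f i ≫ eqToHom (congrArg N.X h) else 0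

theorem reindex_self {M N : Mat_ A} (e : M.ι ≃ N.ι) (f : ∀ i, M.X i ⟶ N.X (e i)) (i : M.ι) :
    reindex e f i (e i) = f i := by
  simp [reindex]

theorem reindex_of_ne {M N : Mat_ A} (e : M.ι ≃ N.ι) (f : ∀ i, M.X i ⟶ N.X (e i)) {i : M.ι}
    {j : N.ι} (h : e i ≠ j) : reindex e f i j = 0 := by
  simp [reindex, h]

theorem reindex_comp_apply {M N K : Mat_ A} (e : M.ι ≃ N.ι) (f : ∀ i, M.X i ⟶ N.X (e i))
    (g : N ⟶ K) (i : M.ι) (l : K.ι) : (reindex e f ≫ g) i l = f i ≫ g (e i) l := by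
  rw [Mat_.comp_apply, Finset.sum_eq_single (e i), reindex_self]
  · intro b _ hb
    rw [reindex_of_ne e f hb.symm, zero_comp]
  · intro h
    exact absurd (Finset.mem_univ _) h

theorem comp_reindex_apply {M N K : Mat_ A} (g : M ⟶ N) (e : N.ι ≃ K.ι)
    (f : ∀ i, N.X i ⟶ K.X (e i)) (i : M.ι) (j : N.ι) :
    (g ≫ reindex e f) i (e j) = g i j ≫ f j := by
  rw [Mat_.comp_apply, Finset.sum_eq_single j, reindex_self]
  · intro b _ hb
    rw [reindex_of_ne e f (fun h => hb (e.injective h)), comp_zero]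
  · intro h
    exact absurd (Finset.mem_univ _) h

/-- Two matrices into `N` agree if they agree after reindexing the target along a bijection. -/
theorem ext_target {M N : Mat_ A} {κ : Type} (e : κ ≃ N.ι) {f g : M ⟶ N}
    (h : ∀ i j, f i (e j) = g i (e j)) : f = g := by
  ext i j
  obtain ⟨j, rfl⟩ := e.surjective j
  exact h i j

theorem id_eq_reindex (M : Mat_ A) : 𝟙 M = reindex (Equiv.refl M.ι) (fun i => 𝟙 (M.X i)) := by
  ext i j
  by_cases h : i = j
  · subst h
    rw [Mat_.id_apply_self]
    exact (reindex_self (Equiv.refl M.ι) (fun i => 𝟙 (M.X i)) i).symm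
  · rw [Mat_.id_apply_of_ne _ _ _ h]
    exact (reindex_of_ne (Equiv.refl M.ι) (fun i => 𝟙 (M.X i)) h).symm

theorem reindex_comp_reindex {M N K : Mat_ A} (e : M.ι ≃ N.ι) (f : ∀ i, M.X i ⟶ N.X (e i))
    (e' : N.ι ≃ K.ι) (f' : ∀ i, N.X i ⟶ K.X (e' i)) :
    reindex e f ≫ reindex e' f' = reindex (e.trans e') (fun i => f i ≫ f' (e i)) := by
  ext i l
  rw [reindex_comp_apply]
  by_cases h : e' (e i) = l
  · subst h
    rw [reindex_self]
    exact (reindex_self (e.trans e') (fun i => f i ≫ f' (e i)) i).symm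
  · rw [reindex_of_ne e' f' h, comp_zero]
    exact (reindex_of_ne (e.trans e') (fun i => f i ≫ f' (e i)) h).symm

theorem reindex_congr {M N : Mat_ A} {e e' : M.ι ≃ N.ι} {f : ∀ i, M.X i ⟶ N.X (e i)}
    {f' : ∀ i, M.X i ⟶ N.X (e' i)} (h : ∀ i, e i = e' i)
    (hf : ∀ i, f i ≫ eqToHom (congrArg N.X (h i)) = f' i) : reindex e f = reindex e' f' := by
  obtain rfl : e = e' := Equiv.ext h
  refine congrArg _ (funext fun i => ?_)
  rw [← hf i, eqToHom_refl, Category.comp_id]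

theorem eqToHom_comp_family {B : Type*} [Category* B] {ι : Type} {X Y : ι → B} (f : ∀ i, X i ⟶ Y i) {i j : ι} (h : i = j) :
    f i ≫ eqToHom (congrArg Y h) = eqToHom (congrArg X h) ≫ f j := by
  subst h
  simp

/-- A bijection of index sets and isomorphisms `X i ≅ Y (e i)` give an isomorphism. -/
def reindexIso {M N : Mat_ A} (e : M.ι ≃ N.ι) (f : ∀ i, M.X i ≅ N.X (e i)) : M ≅ N where
  hom := reindex e (fun i => (f i).hom)
  inv := reindex e.symm (fun j => eqToHom (congrArg N.X (e.apply_symm_apply j).symm) ≫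
    (f (e.symm j)).inv)
  hom_inv_id := by
    refine (reindex_comp_reindex _ _ _ _).trans (Eq.trans ?_ (id_eq_reindex M).symm)
    refine reindex_congr (fun i => e.symm_apply_apply i) (fun i => ?_)
    change ((f i).hom ≫ eqToHom (congrArg N.X (e.apply_symm_apply (e i)).symm) ≫
      (f (e.symm (e i))).inv) ≫ eqToHom (congrArg M.X (e.symm_apply_apply i)) = 𝟙 (M.X i)
    have h := eqToHom_comp_family (X := fun i => N.X (e i)) (Y := M.X) (fun i => (f i).inv)
      (e.symm_apply_apply i)
    rw [Category.assoc, Category.assoc, h, eqToHom_trans_assoc, eqToHom_refl, Category.id_comp,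
      Iso.hom_inv_id]
  inv_hom_id := by
    refine (reindex_comp_reindex _ _ _ _).trans (Eq.trans ?_ (id_eq_reindex N).symm)
    refine reindex_congr (fun i => e.apply_symm_apply i) (fun i => ?_)
    change ((eqToHom (congrArg N.X (e.apply_symm_apply i).symm) ≫ (f (e.symm i)).inv) ≫
      (f (e.symm i)).hom) ≫ eqToHom (congrArg N.X (e.apply_symm_apply i)) = 𝟙 (N.X i)
    rw [Category.assoc, Category.assoc, Iso.inv_hom_id_assoc, eqToHom_trans, eqToHom_refl]

variable [MonoidalCategory A]

/-- The tensor product of formal direct sums, `(⨁ X i) ⊗ (⨁ Y j) = ⨁ X i ⊗ Y j`. -/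
def tensorMat (M N : Mat_ A) : Mat_ A :=
  ⟨M.ι × N.ι, fun p => M.X p.1 ⊗ N.X p.2⟩

instance instMonoidalStruct : MonoidalCategoryStruct (Mat_ A) where
  tensorObj M N := tensorMat M N
  tensorHom f g := fun p q => f p.1 q.1 ⊗ₘ g p.2 q.2
  whiskerLeft M _ _ g := fun p q => (𝟙 M : M ⟶ M) p.1 q.1 ⊗ₘ g p.2 q.2
  whiskerRight f N := fun p q => f p.1 q.1 ⊗ₘ (𝟙 N : N ⟶ N) p.2 q.2
  tensorUnit := ⟨PUnit, fun _ => 𝟙_ A⟩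
  associator M N K := reindexIso (M := tensorMat (tensorMat M N) K)
    (N := tensorMat M (tensorMat N K)) (Equiv.prodAssoc M.ι N.ι K.ι)
    (fun p => α_ (M.X p.1.1) (N.X p.1.2) (K.X p.2))
  leftUnitor M := reindexIso (M := tensorMat ⟨PUnit, fun _ => 𝟙_ A⟩ M) (N := M)
    (Equiv.punitProd M.ι) (fun p => λ_ (M.X p.2))
  rightUnitor M := reindexIso (M := tensorMat M ⟨PUnit, fun _ => 𝟙_ A⟩) (N := M)
    (Equiv.prodPUnit M.ι) (fun p => ρ_ (M.X p.1))

theorem tensorHom_apply {M N M' N' : Mat_ A} (f : M ⟶ N) (g : M' ⟶ N')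
    (p : M.ι × M'.ι) (q : N.ι × N'.ι) :
    (show tensorMat M M' ⟶ tensorMat N N' from f ⊗ₘ g) p q = f p.1 q.1 ⊗ₘ g p.2 q.2 := rfl

theorem associator_naturality_aux {X₁ X₂ X₃ Y₁ Y₂ Y₃ : Mat_ A} (f₁ : X₁ ⟶ Y₁)
    (f₂ : X₂ ⟶ Y₂) (f₃ : X₃ ⟶ Y₃) :
    ((f₁ ⊗ₘ f₂) ⊗ₘ f₃) ≫ (α_ Y₁ Y₂ Y₃).hom = (α_ X₁ X₂ X₃).hom ≫ (f₁ ⊗ₘ (f₂ ⊗ₘ f₃)) := by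
  refine ext_target (M := tensorMat (tensorMat X₁ X₂) X₃) (N := tensorMat Y₁ (tensorMat Y₂ Y₃))
    (Equiv.prodAssoc Y₁.ι Y₂.ι Y₃.ι) (fun p q => ?_)
  refine (comp_reindex_apply (M := tensorMat (tensorMat X₁ X₂) X₃)
    (N := tensorMat (tensorMat Y₁ Y₂) Y₃) (K := tensorMat Y₁ (tensorMat Y₂ Y₃)) _
    (Equiv.prodAssoc Y₁.ι Y₂.ι Y₃.ι) _ p q).trans ?_
  refine Eq.trans ?_ (reindex_comp_apply (M := tensorMat (tensorMat X₁ X₂) X₃)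
    (N := tensorMat X₁ (tensorMat X₂ X₃)) (K := tensorMat Y₁ (tensorMat Y₂ Y₃))
    (Equiv.prodAssoc X₁.ι X₂.ι X₃.ι) _ _ p (Equiv.prodAssoc Y₁.ι Y₂.ι Y₃.ι q)).symm
  exact associator_naturality ..

variable [MonoidalPreadditive A]

theorem reindex_tensor_reindex {M N M' N' : Mat_ A} (e : M.ι ≃ N.ι)
    (f : ∀ i, M.X i ⟶ N.X (e i)) (e' : M'.ι ≃ N'.ι) (f' : ∀ i, M'.X i ⟶ N'.X (e' i)) :
    reindex e f ⊗ₘ reindex e' f' =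
      reindex (M := tensorMat M M') (N := tensorMat N N') (Equiv.prodCongr e e')
        (fun p => f p.1 ⊗ₘ f' p.2) := by
  refine ext_target (κ := M.ι × M'.ι) (Equiv.prodCongr e e') (fun p q => ?_)
  obtain ⟨p, p'⟩ := p
  obtain ⟨q, q'⟩ := q
  refine (tensorHom_apply _ _ (p, p') (e q, e' q')).trans ?_
  by_cases h : p = q
  · subst h
    by_cases h' : p' = q'
    · subst h'
      rw [reindex_self, reindex_self]
      exact (reindex_self (M := tensorMat M M') (N := tensorMat N N') (Equiv.prodCongr e e')
        (fun p => f p.1 ⊗ₘ f' p.2) (p, p')).symm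
    · rw [reindex_of_ne e' f' (fun h => h' (e'.injective h)), MonoidalPreadditive.tensor_zero]
      exact (reindex_of_ne (M := tensorMat M M') (N := tensorMat N N') (Equiv.prodCongr e e')
        (fun p => f p.1 ⊗ₘ f' p.2) (i := (p, p')) (j := (e p, e' q'))
        (fun hh => h' (e'.injective (congrArg Prod.snd hh)))).symm
  · rw [reindex_of_ne e f (fun hh => h (e.injective hh)), MonoidalPreadditive.zero_tensor]
    exact (reindex_of_ne (M := tensorMat M M') (N := tensorMat N N') (Equiv.prodCongr e e')
      (fun p => f p.1 ⊗ₘ f' p.2) (i := (p, p')) (j := (e q, e' q'))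
      (fun hh => h (e.injective (congrArg Prod.fst hh)))).symm

theorem tensor_comp_aux {X₁ Y₁ Z₁ X₂ Y₂ Z₂ : Mat_ A} (f₁ : X₁ ⟶ Y₁) (f₂ : X₂ ⟶ Y₂)
    (g₁ : Y₁ ⟶ Z₁) (g₂ : Y₂ ⟶ Z₂) :
    (f₁ ⊗ₘ f₂) ≫ (g₁ ⊗ₘ g₂) = (f₁ ≫ g₁) ⊗ₘ (f₂ ≫ g₂) := by
  refine Mat_.hom_ext (M := tensorMat X₁ X₂) (N := tensorMat Z₁ Z₂) _ _ (fun p q => ?_)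
  refine (Mat_.comp_apply (M := tensorMat X₁ X₂) (N := tensorMat Y₁ Y₂)
    (K := tensorMat Z₁ Z₂) _ _ p q).trans ?_
  refine Eq.trans ?_ (tensorHom_apply (f₁ ≫ g₁) (f₂ ≫ g₂) p q).symm
  rw [Mat_.comp_apply, Mat_.comp_apply, sum_tensor]
  simp only [tensor_sum]
  refine (Fintype.sum_prod_type _).trans ?_
  refine Finset.sum_congr rfl (fun i _ => Finset.sum_congr rfl (fun j _ => ?_))
  exact tensorHom_comp_tensorHom ..

instance instMonoidal : MonoidalCategory (Mat_ A) :=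
  MonoidalCategory.ofTensorHom
    (id_tensorHom_id := fun M N => by
      refine (congrArg₂ tensorHom (id_eq_reindex M) (id_eq_reindex N)).trans ?_
      refine (reindex_tensor_reindex _ _ _ _).trans (Eq.trans ?_ (id_eq_reindex _).symm)
      exact reindex_congr (M := tensorMat M N) (N := tensorMat M N) (fun _ => rfl)
        (fun p => (Category.comp_id _).trans (id_tensorHom_id _ _)))
    (id_tensorHom := fun _ _ _ _ => rfl)
    (tensorHom_id := fun _ _ => rfl)
    (tensorHom_comp_tensorHom := tensor_comp_aux)
    (associator_naturality := associator_naturality_aux)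
    (leftUnitor_naturality := fun {X Y} f => by
      refine ext_target (M := tensorMat ⟨PUnit, fun _ => 𝟙_ A⟩ X) (N := Y)
        (Equiv.punitProd Y.ι) (fun p q => ?_)
      refine (comp_reindex_apply (M := tensorMat ⟨PUnit, fun _ => 𝟙_ A⟩ X)
        (N := tensorMat ⟨PUnit, fun _ => 𝟙_ A⟩ Y) (K := Y) _
        (Equiv.punitProd Y.ι) _ p q).trans ?_
      refine Eq.trans ?_ (reindex_comp_apply (M := tensorMat ⟨PUnit, fun _ => 𝟙_ A⟩ X)
        (N := X) (K := Y) (Equiv.punitProd X.ι) _ _ p (Equiv.punitProd Y.ι q)).symm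
      refine Eq.trans ?_ (leftUnitor_naturality (f p.2 q.2))
      refine congrArg (· ≫ (λ_ (Y.X q.2)).hom) ?_
      refine (congrArg (· ⊗ₘ f p.2 q.2) (Mat_.id_apply_self _ _)).trans (id_tensorHom _ _))
    (rightUnitor_naturality := fun {X Y} f => by
      refine ext_target (M := tensorMat X ⟨PUnit, fun _ => 𝟙_ A⟩) (N := Y)
        (Equiv.prodPUnit Y.ι) (fun p q => ?_)
      refine (comp_reindex_apply (M := tensorMat X ⟨PUnit, fun _ => 𝟙_ A⟩)
        (N := tensorMat Y ⟨PUnit, fun _ => 𝟙_ A⟩) (K := Y) _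
        (Equiv.prodPUnit Y.ι) _ p q).trans ?_
      refine Eq.trans ?_ (reindex_comp_apply (M := tensorMat X ⟨PUnit, fun _ => 𝟙_ A⟩)
        (N := X) (K := Y) (Equiv.prodPUnit X.ι) _ _ p (Equiv.prodPUnit Y.ι q)).symm
      refine Eq.trans ?_ (rightUnitor_naturality (f p.1 q.1))
      refine congrArg (· ≫ (ρ_ (Y.X q.1)).hom) ?_
      refine (congrArg (f p.1 q.1 ⊗ₘ ·) (Mat_.id_apply_self _ _)).trans (tensorHom_id _ _))
    (pentagon := fun W X Y Z => by
      refine (congrArg₂ (· ≫ ·)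
        ((congrArg (_ ⊗ₘ ·) (id_eq_reindex Z)).trans (reindex_tensor_reindex _ _ _ _))
        (congrArg (_ ≫ ·)
          ((congrArg (· ⊗ₘ _) (id_eq_reindex W)).trans (reindex_tensor_reindex _ _ _ _)))).trans ?_
      refine (congrArg (_ ≫ ·) (reindex_comp_reindex _ _ _ _)).trans ?_
      refine (reindex_comp_reindex _ _ _ _).trans
        (Eq.trans ?_ (reindex_comp_reindex _ _ _ _).symm)
      refine reindex_congr (fun _ => rfl) (fun p => (Category.comp_id _).trans ?_)
      refine Eq.trans ?_ (MonoidalCategory.pentagon (W.X p.1.1.1) (X.X p.1.1.2) (Y.X p.1.2)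
        (Z.X p.2))
      exact congrArg₂ (· ≫ ·) (tensorHom_id _ _) (congrArg (_ ≫ ·) (id_tensorHom _ _)))
    (triangle := fun X Y => by
      refine (congrArg (_ ≫ ·)
          ((congrArg (· ⊗ₘ _) (id_eq_reindex X)).trans (reindex_tensor_reindex _ _ _ _))).trans ?_
      refine (reindex_comp_reindex _ _ _ _).trans (Eq.trans ?_
        ((congrArg (_ ⊗ₘ ·) (id_eq_reindex Y)).trans (reindex_tensor_reindex _ _ _ _)).symm)
      refine reindex_congr (fun _ => rfl) (fun p => (Category.comp_id _).trans ?_)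
      refine Eq.trans ?_ ((MonoidalCategory.triangle (X.X p.1.1) (Y.X p.2)).trans
        (tensorHom_id _ _).symm)
      exact congrArg (_ ≫ ·) (id_tensorHom _ _))

instance instMonoidalPreadditive : MonoidalPreadditive (Mat_ A) where
  whiskerLeft_zero := by
    intros
    refine Mat_.hom_ext (M := tensorMat _ _) (N := tensorMat _ _) _ _ (fun p q => ?_)
    exact MonoidalPreadditive.tensor_zero _
  zero_whiskerRight := by
    intros
    refine Mat_.hom_ext (M := tensorMat _ _) (N := tensorMat _ _) _ _ (fun p q => ?_)
    exact MonoidalPreadditive.zero_tensor _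
  whiskerLeft_add := by
    intros
    refine Mat_.hom_ext (M := tensorMat _ _) (N := tensorMat _ _) _ _ (fun p q => ?_)
    exact MonoidalPreadditive.tensor_add _ _ _
  add_whiskerRight := by
    intros
    refine Mat_.hom_ext (M := tensorMat _ _) (N := tensorMat _ _) _ _ (fun p q => ?_)
    exact MonoidalPreadditive.add_tensor _ _ _

instance instModule (k : Type w) [Field k] [Linear k A] (M N : Mat_ A) : Module k (M ⟶ N) :=
  inferInstanceAs (Module k (∀ (i : M.ι) (j : N.ι), M.X i ⟶ N.X j))

instance instLinear (k : Type w) [Field k] [Linear k A] : Linear k (Mat_ A) where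
  homModule M N := instModule k M N
  smul_comp M N K r f g := by
    ext i l
    refine (Mat_.comp_apply _ _ _ _).trans (Eq.trans ?_
      (congrArg (r • ·) (Mat_.comp_apply f g i l)).symm)
    refine Eq.trans ?_ Finset.smul_sum.symm
    exact Finset.sum_congr rfl (fun j _ => Linear.smul_comp _ _ _ r (f i j) (g j l))
  comp_smul M N K f r g := by
    ext i l
    refine (Mat_.comp_apply _ _ _ _).trans (Eq.trans ?_
      (congrArg (r • ·) (Mat_.comp_apply f g i l)).symm)
    refine Eq.trans ?_ Finset.smul_sum.symm
    exact Finset.sum_congr rfl (fun j _ => Linear.comp_smul _ _ _ (f i j) r (g j l))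

end MatTensor

end AdditiveCompletion

/-! ### Fusion categories, fusion subcategories and gradings -/

section FusionCategories

variable {C : Type u₁} [Category.{v₁} C] [Preadditive C]

/-- The objects isomorphic to a finite direct sum of objects satisfying `P`: the full additive
subcategory generated by `P`. The empty direct sum, the zero object, is allowed. -/
def finiteSums [HasFiniteBiproducts C] (P : ObjectProperty C) : ObjectProperty C :=
  fun Z => ∃ (n : ℕ) (W : Fin n → C), (∀ i, P (W i)) ∧ Nonempty (Z ≅ ⨁ W)

/-- The simple objects of `C` that lie in the full subcategory `P`. -/
def simplesIn (P : ObjectProperty C) : ObjectProperty C := fun X => Simple X ∧ P X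

/-- The set `𝒪(P)` of isomorphism classes of simple objects in the full subcategory `P`.
For `P` closed under subobjects, an object of `P` is simple in `P` iff it is simple in `C`. -/
def SimpleClasses (P : ObjectProperty C) : Type u₁ :=
  _root_.Quotient (isIsomorphicSetoid (simplesIn P).FullSubcategory)

/-- The class in `𝒪(P)` of a simple object `X` of `P`. -/
def SimpleClasses.mk {P : ObjectProperty C} (X : C) (hX : Simple X) (hP : P X) :
    SimpleClasses P :=
  Quotient.mk _ ⟨X, hX, hP⟩

instance instHasFiniteBiproducts (C : Type u₁) [Category.{v₁} C] [Abelian C] :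
    HasFiniteBiproducts C :=
  Abelian.hasFiniteBiproducts

/-- A `k`-linear abelian monoidal category with bilinear tensor product in which every object has
left and right duals is a *fusion category* over `k` if it is semisimple, with finitely many
isomorphism classes of simple objects, finite-dimensional `Hom`-spaces, and a simple unit. -/
class IsFusionCategory (k : Type w) [Field k] (C : Type u₁) [Category.{v₁} C] [Abelian C]
    [Linear k C] [MonoidalCategory C] [MonoidalPreadditive C] [MonoidalLinear k C]
    [RigidCategory C] : Prop where
  semisimple : ∀ X : C, finiteSums (fun Y : C => Simple Y) X
  finite_simples : Finite (SimpleClasses (⊤ : ObjectProperty C))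
  finiteDimensional_hom : ∀ X Y : C, FiniteDimensional k (X ⟶ Y)
  simple_unit : Simple (𝟙_ C)

variable [MonoidalCategory C]

/-- A full tensor subcategory (given by the property of belonging to it): it contains the unit and
is closed under tensor products, finite direct sums, subobjects, quotients, and duals. In
particular it is closed under isomorphisms, so that these properties are the same thing as
(replete) full tensor subcategories. -/
structure IsFusionSubcategory [HasFiniteBiproducts C] (P : ObjectProperty C) : Prop where
  unit : P (𝟙_ C)
  tensor : ∀ {X Y : C}, P X → P Y → P (X ⊗ Y)
  sum : ∀ {Z : C}, finiteSums P Z → P Z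
  sub : ∀ {X Y : C} (f : X ⟶ Y) [Mono f], P Y → P X
  quot : ∀ {X Y : C} (f : X ⟶ Y) [Epi f], P X → P Y
  dual : ∀ {X Y : C}, Nonempty (ExactPairing X Y) → (P X ↔ P Y)

/-- A grading of the fusion subcategory `E` by the group `G`: a map `deg : 𝒪(E) → G` such that
`deg Z = deg X * deg Y` whenever `X`, `Y`, `Z` are simple and `X ⊗ Y` contains `Z`. -/
structure Grading (E : ObjectProperty C) (G : Type t) [Group G] where
  /-- the degree -/
  deg : SimpleClasses E → G
  deg_mul : ∀ {X Y Z : C} (hX : Simple X) (hY : Simple Y) (hZ : Simple Z)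
    (eX : E X) (eY : E Y) (eZ : E Z), (∃ i : Z ⟶ X ⊗ Y, Mono i) →
    deg (SimpleClasses.mk Z hZ eZ) =
      deg (SimpleClasses.mk X hX eX) * deg (SimpleClasses.mk Y hY eY)

namespace Grading

variable {E : ObjectProperty C} {G : Type t} [Group G]

/-- A grading is faithful if `deg : 𝒪(E) → G` is surjective. -/
def IsFaithful (γ : Grading E G) : Prop := Function.Surjective γ.deg

/-- The component `E_g`: the full additive subcategory generated by the simple objects of `E`
of degree `g`. -/
def component [HasFiniteBiproducts C] (γ : Grading E G) (g : G) : ObjectProperty C :=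
  finiteSums (fun X => ∃ (hX : Simple X) (eX : E X), γ.deg (SimpleClasses.mk X hX eX) = g)

end Grading

end FusionCategories

/-! ### Deligne's tensor product and fiber products -/

section Goursat

/-- Deligne's tensor product `C ⊠ D` of two fusion categories over an algebraically closed field:
its objects are the finite formal direct sums of objects `X ⊠ Y`, its morphisms are matrices with
entries in `Hom(X ⊠ Y, X' ⊠ Y') = Hom(X, X') ⊗_k Hom(Y, Y')`, and its tensor product is given by
`(X ⊠ Y) ⊗ (X' ⊠ Y') = (X ⊗ X') ⊠ (Y ⊗ Y')`. As `End(X) = k` for every simple object `X`, this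
category is semisimple with simple objects `X ⊠ Y` for `X` and `Y` simple; it is therefore abelian,
and has the universal property of Deligne's tensor product. -/
abbrev DeligneProduct (k : Type w) [Field k] (C : Type u₁) [Category.{v₁} C] [Preadditive C]
    [Linear k C] (D : Type u₂) [Category.{v₂} D] [Preadditive D] [Linear k D] :=
  Mat_ (LinTensor k C D)

variable (k : Type w) [Field k] {C : Type u₁} [Category.{v₁} C] [Preadditive C] [Linear k C]
  {D : Type u₂} [Category.{v₂} D] [Preadditive D] [Linear k D]

/-- The object `X ⊠ Y` of `C ⊠ D`. -/
def box (X : C) (Y : D) : DeligneProduct k C D :=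
  (Mat_.embedding (LinTensor k C D)).obj ⟨X, Y⟩

/-- For full additive subcategories `P` of `C` and `Q` of `D`, the full subcategory `P ⊠ Q` of
`C ⊠ D`: the finite direct sums of objects `X ⊠ Y` with `X` in `P` and `Y` in `Q`. -/
def boxSubcategory (P : ObjectProperty C) (Q : ObjectProperty D) :
    ObjectProperty (DeligneProduct k C D) :=
  finiteSums (fun Z => ∃ (X : C) (Y : D), P X ∧ Q Y ∧ Z = box k X Y)

variable (C D) in
/-- A *subcategory datum* for `C ⊠ D`: fusion subcategories `E` of `C` and `F` of `D`, a finite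
group `G`, and faithful gradings of `E` and `F` by `G`. -/
structure SubcategoryDatum [HasFiniteBiproducts C] [HasFiniteBiproducts D] [MonoidalCategory C]
    [MonoidalCategory D] where
  /-- the fusion subcategory of `C` -/
  E : ObjectProperty C
  /-- the fusion subcategory of `D` -/
  F : ObjectProperty D
  fusion_E : IsFusionSubcategory E
  fusion_F : IsFusionSubcategory F
  /-- the grading group -/
  G : Type t
  [group : Group G]
  [finite : Finite G]
  /-- the grading of `E` -/
  gradE : Grading E G
  /-- the grading of `F` -/
  gradF : Grading F G
  faithful_E : gradE.IsFaithful
  faithful_F : gradF.IsFaithful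

attribute [instance] SubcategoryDatum.group SubcategoryDatum.finite

namespace SubcategoryDatum

variable [HasFiniteBiproducts C] [HasFiniteBiproducts D] [MonoidalCategory C] [MonoidalCategory D]

/-- Two subcategory data are identified if they have the same subcategories `E` and `F` and there
is an isomorphism `α` of the groups with `E_g = E'_{α g}` and `F_g = F'_{α g}` for all `g`. -/
def Equivalent (d d' : SubcategoryDatum.{v₁, v₂, u₁, u₂, t} C D) : Prop :=
  d.E = d'.E ∧ d.F = d'.F ∧ ∃ α : d.G ≃* d'.G,
    ∀ g, d.gradE.component g = d'.gradE.component (α g) ∧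
      d.gradF.component g = d'.gradF.component (α g)

instance instSetoid : Setoid (SubcategoryDatum.{v₁, v₂, u₁, u₂, t} C D) where
  r := Equivalent
  iseqv :=
    { refl := fun d => ⟨rfl, rfl, MulEquiv.refl d.G, fun _ => ⟨rfl, rfl⟩⟩
      symm := by
        rintro d d' ⟨hE, hF, α, h⟩
        refine ⟨hE.symm, hF.symm, α.symm, fun g => ?_⟩
        have := h (α.symm g)
        rw [MulEquiv.apply_symm_apply] at this
        exact ⟨this.1.symm, this.2.symm⟩
      trans := by
        rintro d d' d'' ⟨hE, hF, α, h⟩ ⟨hE', hF', α', h'⟩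
        exact ⟨hE.trans hE', hF.trans hF', α.trans α', fun g =>
          ⟨(h g).1.trans (h' (α g)).1, (h g).2.trans (h' (α g)).2⟩⟩ }

/-- The fiber product `E ⊠_G F = ⨁_{g ∈ G} E_g ⊠ F_g`, as a full subcategory of `C ⊠ D`: the
objects of the form `⨁_{g ∈ G} W_g` with `W_g` in `E_g ⊠ F_g`. -/
def fiberProduct (d : SubcategoryDatum.{v₁, v₂, u₁, u₂, t} C D) :
    ObjectProperty (DeligneProduct k C D) :=
  fun Z => ∃ W : d.G → DeligneProduct k C D,
    (∀ g, boxSubcategory k (d.gradE.component g) (d.gradF.component g) (W g)) ∧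
      Nonempty (Z ≅ ⨁ W)

theorem fiberProduct_le {d d' : SubcategoryDatum.{v₁, v₂, u₁, u₂, t} C D} (h : d ≈ d')
    (Z : DeligneProduct k C D) (hZ : d.fiberProduct k Z) : d'.fiberProduct k Z := by
  obtain ⟨_, _, α, hα⟩ := h
  obtain ⟨W, hW, ⟨e⟩⟩ := hZ
  refine ⟨fun g => W (α.symm g), fun g => ?_,
    ⟨e ≪≫ (biproduct.whiskerEquiv α.symm.toEquiv (fun g => Iso.refl (W (α.symm g)))).symm⟩⟩
  have h := hα (α.symm g)
  rw [MulEquiv.apply_symm_apply] at h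
  rw [← h.1, ← h.2]
  exact hW _

theorem fiberProduct_eq {d d' : SubcategoryDatum.{v₁, v₂, u₁, u₂, t} C D} (h : d ≈ d') :
    d.fiberProduct k = d'.fiberProduct k :=
  le_antisymm (fiberProduct_le k h) (fiberProduct_le k (Setoid.symm h))

/-- The assignment `(E, F, G) ↦ E ⊠_G F` on the set of subcategory data up to identification. -/
def fiberProductClass (x : _root_.Quotient (instSetoid.{v₁, v₂, u₁, u₂, t} (C := C) (D := D))) :
    ObjectProperty (DeligneProduct k C D) :=
  Quotient.lift (fiberProduct k) (fun _ _ h => fiberProduct_eq k h) x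

end SubcategoryDatum

end Goursat

end Fusion

end

/-! This is Goursat's lemma for fusion categories. A fusion subcategory of a semisimple category is
determined by the simple objects in it (`SimpleSystem.supported_eq`). In `C ⊠ D` the simple objects
are the `X ⊠ Y` with `X`, `Y` simple, so a fusion subcategory amounts to a relation `T X Y` between
simple objects of `C` and of `D` that respects units, constituents of tensor products, and duals
(`IsFusionRelation`).

The heart is that such a `T` is difunctional: `T X Y`, `T X' Y` and `T X Y'` imply `T X' Y'`. Some
simple `W` in `X' ⊗ X*` satisfies `X' ⊂ W ⊗ X`. Since the unit lies in `Y ⊗ Y*`, the pair `(W, 1)`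
is related; tensoring it with `(X, Y')` gives `(X', Y')`. Hence "having a common partner" is an
equivalence relation on the simple objects occurring on the left, its classes match those on the
right, and the tensor product turns the set of classes into a finite group `G` that grades both
projections of `T` faithfully, with `T X Y` iff `deg X = deg Y`.

Conversely, a datum yields the relation `deg X = deg Y`, whose fusion subcategory is the fiber
product (`fiberProduct_eq_supported`). Faithfulness makes the projections of this relation equal to
the simple objects of `E` and `F`, and makes the group with its two gradings recoverable from the
relation (`equivalent_of_rel_eq`).

Containment is expressed throughout by `HasHom`, the existence of a nonzero morphism. In a
semisimple category this detects constituents. In `C ⊠ D` it splits into the two factors, because a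
tensor product of vector spaces is nonzero iff both are. `SimpleSystem` axiomatizes the
semisimplicity needed, so that no abelian structure on `Mat_` is required. -/

noncomputable section

namespace Fusion

/-! ### Nonzero morphisms -/

section HasHom

variable {B : Type u₁} [Category.{v₁} B] [Preadditive B]

/-- There is a nonzero morphism from `X` to `Y`. -/
def HasHom (X Y : B) : Prop := ∃ f : X ⟶ Y, f ≠ 0

theorem HasHom.comp_mono {X Y Z : B} (h : HasHom X Y) (f : Y ⟶ Z) [Mono f] : HasHom X Z := by
  obtain ⟨g, hg⟩ := h
  exact ⟨g ≫ f, fun h0 => hg (zero_of_comp_mono f h0)⟩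

theorem HasHom.epi_comp {X Y Z : B} (h : HasHom Y Z) (f : X ⟶ Y) [Epi f] : HasHom X Z := by
  obtain ⟨g, hg⟩ := h
  exact ⟨f ≫ g, fun h0 => hg (zero_of_epi_comp f h0)⟩

theorem HasHom.congr {X Y X' Y' : B} (e : X ≅ X') (e' : Y ≅ Y') : HasHom X Y ↔ HasHom X' Y' :=
  ⟨fun h => (h.comp_mono e'.hom).epi_comp e.inv, fun h => (h.comp_mono e'.inv).epi_comp e.hom⟩

theorem hasHom_biproduct_right {J : Type*} {W : J → B} [HasBiproduct W] {X : B} :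
    HasHom X (⨁ W) ↔ ∃ j, HasHom X (W j) := by
  constructor
  · rintro ⟨f, hf⟩
    by_contra! h
    refine hf (biproduct.hom_ext _ _ fun j => ?_)
    by_contra h0
    exact h j ⟨f ≫ biproduct.π W j, fun h1 => h0 (h1.trans zero_comp.symm)⟩
  · rintro ⟨j, h⟩
    exact h.comp_mono (biproduct.ι W j)

theorem hasHom_biproduct_left {J : Type*} {W : J → B} [HasBiproduct W] {X : B} :
    HasHom (⨁ W) X ↔ ∃ j, HasHom (W j) X := by
  constructor
  · rintro ⟨f, hf⟩
    by_contra! h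
    refine hf (biproduct.hom_ext' _ _ fun j => ?_)
    by_contra h0
    exact h j ⟨biproduct.ι W j ≫ f, fun h1 => h0 (h1.trans comp_zero.symm)⟩
  · rintro ⟨j, h⟩
    exact h.epi_comp (biproduct.π W j)

end HasHom

/-! ### Finite direct sums -/

section FiniteSums

variable {B : Type u₁} [Category.{v₁} B] [Preadditive B] [HasFiniteBiproducts B]

theorem finiteSums_of_finite {P : ObjectProperty B} {J : Type*} [Finite J] {W : J → B}
    (hW : ∀ j, P (W j)) {Z : B} (e : Z ≅ ⨁ W) : finiteSums P Z := by
  obtain ⟨n, ⟨σ⟩⟩ := Finite.exists_equiv_fin J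
  exact ⟨n, fun i => W (σ.symm i), fun i => hW _,
    ⟨e ≪≫ (biproduct.whiskerEquiv σ.symm (fun _ => Iso.refl _)).symm⟩⟩

theorem finiteSums_of_mem {P : ObjectProperty B} {Z : B} (h : P Z) : finiteSums P Z :=
  finiteSums_of_finite (J := PUnit.{1}) (W := fun _ => Z) (fun _ => h)
    (biproductUniqueIso (fun _ : PUnit.{1} => Z)).symm

theorem finiteSums_mono {P Q : ObjectProperty B} (h : ∀ Z, P Z → Q Z) {Z : B}
    (hZ : finiteSums P Z) : finiteSums Q Z := by
  obtain ⟨n, W, hW, e⟩ := hZ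
  exact ⟨n, W, fun i => h _ (hW i), e⟩

theorem finiteSums_biproduct {P : ObjectProperty B} {J : Type*} [Finite J] {W : J → B}
    (hW : ∀ j, finiteSums P (W j)) {Z : B} (e : Z ≅ ⨁ W) : finiteSums P Z := by
  choose n V hV hiso using hW
  let e' (j : J) : W j ≅ ⨁ V j := (hiso j).some
  exact finiteSums_of_finite (J := Σ j, Fin (n j)) (W := fun p => V p.1 p.2) (fun p => hV _ _)
    (e ≪≫ biproduct.mapIso e' ≪≫ biproductBiproductIso (fun j => Fin (n j)) V)

theorem finiteSums_finiteSums {P : ObjectProperty B} {Z : B}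
    (hZ : finiteSums (finiteSums P) Z) : finiteSums P Z := by
  obtain ⟨n, W, hW, ⟨e⟩⟩ := hZ
  exact finiteSums_biproduct hW e

theorem finiteSums_map {A : Type u₂} [Category.{v₂} A] [Preadditive A] [HasFiniteBiproducts A]
    (F : A ⥤ B) [F.Additive] {P : ObjectProperty A} {Q : ObjectProperty B}
    (h : ∀ X, P X → Q (F.obj X)) {Z : A} (hZ : finiteSums P Z) : finiteSums Q (F.obj Z) := by
  obtain ⟨n, W, hW, ⟨e⟩⟩ := hZ
  exact ⟨n, fun i => F.obj (W i), fun i => h _ (hW i), ⟨F.mapIso e ≪≫ F.mapBiproduct W⟩⟩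

variable [MonoidalCategory B] [MonoidalPreadditive B]

/-- The tensor product distributes over finite direct sums, and a nonzero morphism into a direct sum
has a nonzero component. -/
theorem HasHom.exists_tensor {P Q : ObjectProperty B} {A X Y : B} (hX : finiteSums P X)
    (hY : finiteSums Q Y) (h : HasHom A (X ⊗ Y)) :
    ∃ X' Y', P X' ∧ Q Y' ∧ HasHom A (X' ⊗ Y') := by
  obtain ⟨n, W, hW, ⟨e⟩⟩ := hX
  obtain ⟨m, V, hV, ⟨e'⟩⟩ := hY
  have h1 := (HasHom.congr (Iso.refl A) ((e ⊗ᵢ e') ≪≫ rightDistributor W (⨁ V))).1 h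
  obtain ⟨i, hi⟩ := hasHom_biproduct_right.1 h1
  have h2 := (HasHom.congr (Iso.refl A) (leftDistributor (W i) V)).1 hi
  obtain ⟨j, hj⟩ := hasHom_biproduct_right.1 h2
  exact ⟨W i, V j, hW i, hV j, hj⟩

theorem HasHom.exists_tensor_left {P : ObjectProperty B} {A X Z : B} (hX : finiteSums P X)
    (h : HasHom (X ⊗ A) Z) : ∃ X', P X' ∧ HasHom (X' ⊗ A) Z := by
  obtain ⟨n, W, hW, ⟨e⟩⟩ := hX
  obtain ⟨i, hi⟩ := hasHom_biproduct_left.1 ((HasHom.congr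
    (whiskerRightIso e A ≪≫ rightDistributor W A) (Iso.refl Z)).1 h)
  exact ⟨W i, hW i, hi⟩

theorem HasHom.exists_tensor_right {P : ObjectProperty B} {A X Z : B} (hX : finiteSums P X)
    (h : HasHom (A ⊗ X) Z) : ∃ X', P X' ∧ HasHom (A ⊗ X') Z := by
  obtain ⟨n, W, hW, ⟨e⟩⟩ := hX
  obtain ⟨i, hi⟩ := hasHom_biproduct_left.1 ((HasHom.congr
    (whiskerLeftIso A e ≪≫ leftDistributor A W) (Iso.refl Z)).1 h)
  exact ⟨W i, hW i, hi⟩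

end FiniteSums

/-! ### Duals and nonzero morphisms -/

section Duals

variable {B : Type u₁} [Category.{v₁} B] [Preadditive B] [MonoidalCategory B]
  [MonoidalPreadditive B]

/-- The duality adjunction is a bijection of Hom-sets that sends zero to zero. -/
theorem hasHom_tensor_left_iff (X Y Y' Z : B) [ExactPairing Y Y'] :
    HasHom (Y' ⊗ X) Z ↔ HasHom X (Y ⊗ Z) := by
  have h0 : tensorLeftHomEquiv X Y Y' Z 0 = 0 := by simp [tensorLeftHomEquiv]
  constructor
  · rintro ⟨f, hf⟩
    exact ⟨tensorLeftHomEquiv X Y Y' Z f, fun h => hf ((Equiv.injective _) (h.trans h0.symm))⟩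
  · rintro ⟨f, hf⟩
    refine ⟨(tensorLeftHomEquiv X Y Y' Z).symm f, fun h => hf ?_⟩
    rw [Equiv.symm_apply_eq] at h
    exact h.trans h0

theorem hasHom_tensor_right_iff (X Y Y' Z : B) [ExactPairing Y Y'] :
    HasHom (X ⊗ Y) Z ↔ HasHom X (Z ⊗ Y') := by
  have h0 : tensorRightHomEquiv X Y Y' Z 0 = 0 := by simp [tensorRightHomEquiv]
  constructor
  · rintro ⟨f, hf⟩
    exact ⟨tensorRightHomEquiv X Y Y' Z f, fun h => hf ((Equiv.injective _) (h.trans h0.symm))⟩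
  · rintro ⟨f, hf⟩
    refine ⟨(tensorRightHomEquiv X Y Y' Z).symm f, fun h => hf ?_⟩
    rw [Equiv.symm_apply_eq] at h
    exact h.trans h0

/-- `X ⊗ Y → 1` is a map `X → Y'`, for `Y'` right dual to `Y`. -/
theorem hasHom_tensor_unit_iff_right (X Y Y' : B) [ExactPairing Y Y'] :
    HasHom (X ⊗ Y) (𝟙_ B) ↔ HasHom X Y' :=
  (hasHom_tensor_right_iff X Y Y' (𝟙_ B)).trans (HasHom.congr (Iso.refl _) (λ_ Y'))

theorem hasHom_tensor_unit_iff_left (X Y Y' : B) [ExactPairing Y Y'] :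
    HasHom (Y' ⊗ X) (𝟙_ B) ↔ HasHom X Y :=
  (hasHom_tensor_left_iff X Y Y' (𝟙_ B)).trans (HasHom.congr (Iso.refl _) (ρ_ Y))

theorem hasHom_unit_tensor_iff (Y Y' Z : B) [ExactPairing Y Y'] :
    HasHom (𝟙_ B) (Y ⊗ Z) ↔ HasHom Y' Z :=
  (hasHom_tensor_left_iff (𝟙_ B) Y Y' Z).symm.trans (HasHom.congr (ρ_ Y') (Iso.refl _))

end Duals

/-! ### Semisimple categories -/

section SimpleSystem

variable {B : Type u₁} [Category.{v₁} B] [Preadditive B] [HasFiniteBiproducts B]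

/-- A family of nonzero objects satisfying Schur's lemma, such that every object is a finite direct
sum of members of the family. -/
structure SimpleSystem {ι : Type*} (s : ι → B) : Prop where
  decomp : ∀ X : B, finiteSums (fun Y => ∃ i, Y = s i) X
  isIso : ∀ {i j : ι} (f : s i ⟶ s j), f ≠ 0 → IsIso f
  id_ne_zero : ∀ i, 𝟙 (s i) ≠ 0

/-- The objects all of whose constituents belong to `T`. -/
def supported {ι : Type*} (s : ι → B) (T : ι → Prop) : ObjectProperty B :=
  fun M => ∀ i, HasHom (s i) M → T i

namespace SimpleSystem

variable {ι : Type*} {s : ι → B} (hs : SimpleSystem s)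

include hs

theorem hasHom_self (i : ι) : HasHom (s i) (s i) := ⟨_, hs.id_ne_zero i⟩

theorem iso_of_hasHom {i j : ι} (h : HasHom (s i) (s j)) : Nonempty (s i ≅ s j) := by
  obtain ⟨f, hf⟩ := h
  have := hs.isIso f hf
  exact ⟨asIso f⟩

/-- Some component of `f` along a decomposition of `M` is nonzero, hence invertible by Schur's
lemma; project onto that summand and invert. -/
theorem exists_retraction {i : ι} {M : B} (f : s i ⟶ M) (hf : f ≠ 0) :
    ∃ g : M ⟶ s i, f ≫ g = 𝟙 _ := by
  obtain ⟨n, W, hW, ⟨e⟩⟩ := hs.decomp M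
  have : ∃ j, f ≫ e.hom ≫ biproduct.π W j ≠ 0 := by
    by_contra! h
    refine hf (zero_of_comp_mono e.hom (biproduct.hom_ext _ _ fun j => ?_))
    rw [Category.assoc, h j, zero_comp]
  obtain ⟨j, hj⟩ := this
  obtain ⟨i', hi'⟩ := hW j
  -- The equality of objects `W j = s i'` can be substituted only once the composite is generalized
  -- to an arbitrary morphism.
  have : IsIso (f ≫ e.hom ≫ biproduct.π W j) := by
    revert hj
    generalize f ≫ e.hom ≫ biproduct.π W j = q
    revert q
    rw [hi']
    exact fun q hq => hs.isIso q hq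
  exact ⟨e.hom ≫ biproduct.π W j ≫ inv (f ≫ e.hom ≫ biproduct.π W j), by
    have := IsIso.hom_inv_id (f ≫ e.hom ≫ biproduct.π W j)
    rwa [Category.assoc, Category.assoc] at this⟩

theorem exists_section {i : ι} {M : B} (f : M ⟶ s i) (hf : f ≠ 0) :
    ∃ g : s i ⟶ M, g ≫ f = 𝟙 _ := by
  obtain ⟨n, W, hW, ⟨e⟩⟩ := hs.decomp M
  have : ∃ j, (biproduct.ι W j ≫ e.inv) ≫ f ≠ 0 := by
    by_contra! h
    refine hf (zero_of_epi_comp e.inv (biproduct.hom_ext' _ _ fun j => ?_))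
    rw [← Category.assoc, h j, comp_zero]
  obtain ⟨j, hj⟩ := this
  obtain ⟨i', hi'⟩ := hW j
  have : IsIso ((biproduct.ι W j ≫ e.inv) ≫ f) := by
    revert hj
    generalize (biproduct.ι W j ≫ e.inv) ≫ f = q
    revert q
    rw [hi']
    exact fun q hq => hs.isIso q hq
  exact ⟨inv ((biproduct.ι W j ≫ e.inv) ≫ f) ≫ biproduct.ι W j ≫ e.inv, by
    have := IsIso.inv_hom_id ((biproduct.ι W j ≫ e.inv) ≫ f)
    simpa only [Category.assoc] using this⟩

/-- Subobjects and quotients have the same simple constituents, because nonzero maps from or to a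
simple object split. -/
theorem hasHom_comm {i : ι} {M : B} : HasHom (s i) M ↔ HasHom M (s i) := by
  constructor
  · rintro ⟨f, hf⟩
    obtain ⟨g, hg⟩ := hs.exists_retraction f hf
    exact ⟨g, fun h => hs.id_ne_zero i (by rw [← hg, h, comp_zero])⟩
  · rintro ⟨f, hf⟩
    obtain ⟨g, hg⟩ := hs.exists_section f hf
    exact ⟨g, fun h => hs.id_ne_zero i (by rw [← hg, h, zero_comp])⟩

/-- A nonzero morphism into `M` has nonzero components along the constituents of `M`. -/
theorem exists_constituent {X M : B} (h : HasHom X M) : ∃ i, HasHom X (s i) ∧ HasHom (s i) M := by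
  obtain ⟨n, W, hW, ⟨e⟩⟩ := hs.decomp M
  obtain ⟨j, hj⟩ := hasHom_biproduct_right.1 ((HasHom.congr (Iso.refl X) e).1 h)
  obtain ⟨i, hi⟩ := hW j
  rw [hi] at hj
  exact ⟨i, hj, (HasHom.congr (Iso.refl _) e).2 (hasHom_biproduct_right.2
    ⟨j, hi ▸ hs.hasHom_self i⟩)⟩

/-- Every object is the direct sum of its constituents. -/
theorem decomp_constituents (M : B) : finiteSums (fun Y => ∃ i, Y = s i ∧ HasHom (s i) M) M := by
  obtain ⟨n, W, hW, ⟨e⟩⟩ := hs.decomp M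
  refine ⟨n, W, fun j => ?_, ⟨e⟩⟩
  obtain ⟨i, hi⟩ := hW j
  refine ⟨i, hi, (HasHom.congr (Iso.refl _) e).2 (hasHom_biproduct_right.2 ⟨j, ?_⟩)⟩
  rw [hi]
  exact hs.hasHom_self i

variable [MonoidalCategory B] [MonoidalPreadditive B]

/-- All closure properties reduce to simple constituents. For duals, a constituent `s i` of the dual
of `X` gives a nonzero map `s i ⊗ X ⟶ 𝟙_ B`, and therefore one `s i ⊗ s j ⟶ 𝟙_ B` for a constituent
`s j` of `X`. -/
theorem isFusionSubcategory_supported {T : ι → Prop}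
    (unit : ∀ i, HasHom (s i) (𝟙_ B) → T i)
    (tensor : ∀ i j l, T i → T j → HasHom (s l) (s i ⊗ s j) → T l)
    (dual : ∀ i j, HasHom (s i ⊗ s j) (𝟙_ B) → (T i ↔ T j)) :
    IsFusionSubcategory (supported s T) where
  unit := unit
  tensor {X Y} hX hY i hi := by
    obtain ⟨_, _, ⟨j, rfl, hj⟩, ⟨l, rfl, hl⟩, h⟩ :=
      hi.exists_tensor (hs.decomp_constituents X) (hs.decomp_constituents Y)
    exact tensor j l i (hX j hj) (hY l hl) h
  sum := by
    rintro Z ⟨n, W, hW, ⟨e⟩⟩ i hi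
    obtain ⟨j, hj⟩ := hasHom_biproduct_right.1 ((HasHom.congr (Iso.refl _) e).1 hi)
    exact hW j i hj
  sub f _ hY i hi := hY i (hi.comp_mono f)
  quot f _ hX i hi := hX i (hs.hasHom_comm.2 ((hs.hasHom_comm.1 hi).epi_comp f))
  dual := by
    rintro X Y ⟨_⟩
    constructor
    · intro hX i hi
      obtain ⟨_, ⟨j, rfl, hj⟩, h⟩ := HasHom.exists_tensor_right (hs.decomp_constituents X)
        ((hasHom_tensor_unit_iff_right (s i) X Y).2 hi)
      exact (dual i j h).2 (hX j hj)
    · intro hY i hi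
      obtain ⟨_, ⟨j, rfl, hj⟩, h⟩ := HasHom.exists_tensor_left (hs.decomp_constituents Y)
        ((hasHom_tensor_unit_iff_left (s i) X Y).2 hi)
      exact (dual j i h).1 (hY j hj)

omit [MonoidalPreadditive B] in
theorem mem_of_hasHom {P : ObjectProperty B} (hP : IsFusionSubcategory P) {i : ι} {M : B}
    (h : HasHom (s i) M) (hM : P M) : P (s i) := by
  obtain ⟨f, hf⟩ := h
  obtain ⟨g, hg⟩ := hs.exists_retraction f hf
  have : Mono f := ⟨fun a b hab => by
    rw [← Category.comp_id a, ← Category.comp_id b, ← hg, ← Category.assoc, hab, Category.assoc]⟩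
  exact hP.sub f hM

omit [MonoidalPreadditive B] in
/-- A fusion subcategory is determined by the simple objects in it. -/
theorem supported_eq {P : ObjectProperty B} (hP : IsFusionSubcategory P) :
    supported s (fun i => P (s i)) = P := by
  funext M
  refine propext ⟨fun h => ?_, fun h i hi => hs.mem_of_hasHom hP hi h⟩
  refine hP.sum (finiteSums_mono ?_ (hs.decomp_constituents M))
  rintro _ ⟨i, rfl, hi⟩
  exact h i hi

/-- Dual simple objects lie in the same fusion subcategories. -/
theorem mem_iff_of_hasHom_unit {P : ObjectProperty B} (hP : IsFusionSubcategory P) {i j : ι}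
    {L R : B} [ExactPairing L (s i)] [ExactPairing (s j) R]
    (h : HasHom (s i ⊗ s j) (𝟙_ B)) : P (s i) ↔ P (s j) :=
  ⟨fun hi => hs.mem_of_hasHom hP ((hasHom_tensor_unit_iff_left (s j) L (s i)).1 h)
      ((hP.dual ⟨inferInstance⟩).2 hi),
    fun hj => hs.mem_of_hasHom hP ((hasHom_tensor_unit_iff_right (s i) (s j) R).1 h)
      ((hP.dual ⟨inferInstance⟩).1 hj)⟩

end SimpleSystem

end SimpleSystem

/-! ### Simple objects of a fusion category -/

section FusionCategory

variable (k : Type w) [Field k] {C : Type u₁} [Category.{v₁} C] [Abelian C] [Linear k C]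
  [MonoidalCategory C] [MonoidalPreadditive C] [MonoidalLinear k C] [RigidCategory C]
  [IsFusionCategory k C]

variable (C) in
/-- The simple objects of `C`. -/
abbrev SimpleObj : Type u₁ := {X : C // Simple X}

variable (C) in
include k in
theorem simpleSystem : SimpleSystem (Subtype.val : SimpleObj C → C) where
  decomp X := finiteSums_mono (fun Y hY => ⟨⟨Y, hY⟩, rfl⟩) (IsFusionCategory.semisimple k X)
  isIso {i j} f hf := by
    have := i.2
    have := j.2
    exact isIso_of_hom_simple hf
  id_ne_zero i := by
    have := i.2
    exact id_nonzero i.1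

variable (C) in
/-- The unit object, as a simple object. -/
def unitObj : SimpleObj C := ⟨𝟙_ C, IsFusionCategory.simple_unit k⟩

-- The dual of `X` is nonzero, since its endomorphisms correspond to those of `X`. Any simple
-- constituent of it pairs with `X` on both sides, so the simplicity of the dual itself is not
-- needed.
include k in
theorem exists_dual (X : SimpleObj C) : ∃ Y : SimpleObj C,
    HasHom (X.1 ⊗ Y.1) (𝟙_ C) ∧ HasHom (Y.1 ⊗ X.1) (𝟙_ C) := by
  have hs := simpleSystem k C
  have hne : HasHom (X.1)ᘁ (X.1)ᘁ := by
    rw [← hasHom_unit_tensor_iff X.1 (X.1)ᘁ, ← hasHom_tensor_right_iff (𝟙_ C) X.1 (X.1)ᘁ]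
    exact (HasHom.congr (λ_ X.1) (Iso.refl _)).2 (hs.hasHom_self X)
  obtain ⟨Y, hY, hY'⟩ := hs.exists_constituent hne
  refine ⟨Y, (hs.hasHom_comm (i := unitObj k C)).1 ((hasHom_unit_tensor_iff X.1 _ Y.1).2 hY), ?_⟩
  exact (hasHom_tensor_unit_iff_right Y.1 X.1 _).2 hY'

include k in
/-- `X` is contained in `X ⊗ (A ⊗ B)`, through some simple `W` contained in `X ⊗ A`. -/
theorem exists_intermediate (X A B : SimpleObj C) (h : HasHom (A.1 ⊗ B.1) (𝟙_ C)) :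
    ∃ W : SimpleObj C, HasHom W.1 (X.1 ⊗ A.1) ∧ HasHom X.1 (W.1 ⊗ B.1) := by
  have hs := simpleSystem k C
  -- By semisimplicity the unit is a retract of `A ⊗ B`, and retracts survive tensoring with `X`.
  obtain ⟨f, r, hr⟩ : ∃ (f : 𝟙_ C ⟶ A.1 ⊗ B.1) (r : A.1 ⊗ B.1 ⟶ 𝟙_ C), f ≫ r = 𝟙 _ := by
    obtain ⟨f, hf⟩ := (hs.hasHom_comm (i := unitObj k C)).2 h
    exact ⟨f, hs.exists_retraction (i := unitObj k C) f hf⟩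
  have : IsSplitMono (X.1 ◁ f) := IsSplitMono.mk' ⟨X.1 ◁ r, by
    rw [← MonoidalCategory.whiskerLeft_comp, hr, whiskerLeft_id]⟩
  have h1 : HasHom X.1 (X.1 ⊗ (A.1 ⊗ B.1)) :=
    ((HasHom.congr (Iso.refl _) (ρ_ X.1)).2 (hs.hasHom_self X)).comp_mono (X.1 ◁ f)
  -- This choice of `Q` keeps `B` whole, so that only `X ⊗ A` is decomposed.
  obtain ⟨_, _, ⟨W, rfl, hW⟩, rfl, h2⟩ := HasHom.exists_tensor (Q := fun Y => Y = B.1)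
    (hs.decomp_constituents (X.1 ⊗ A.1)) (finiteSums_of_mem rfl)
    ((HasHom.congr (Iso.refl _) (α_ X.1 A.1 B.1).symm).1 h1)
  exact ⟨W, hW, h2⟩

end FusionCategory

/-! ### Nonzero morphisms in Deligne's tensor product -/

/-- A matrix is nonzero iff one of its entries is. -/
theorem hasHom_mat_iff {A : Type u₁} [Category.{v₁} A] [Preadditive A] {M N : Mat_ A} :
    HasHom M N ↔ ∃ i j, HasHom (M.X i) (N.X j) := by
  rw [HasHom.congr (Mat_.isoBiproductEmbedding M) (Mat_.isoBiproductEmbedding N),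
    hasHom_biproduct_left]
  refine exists_congr fun i => hasHom_biproduct_right.trans (exists_congr fun j => ?_)
  constructor
  · rintro ⟨f, hf⟩
    refine ⟨f PUnit.unit PUnit.unit, fun h => hf ?_⟩
    exact Mat_.hom_ext _ _ fun _ _ => h
  · rintro ⟨f, hf⟩
    exact ⟨(Mat_.embedding A).map f, fun h => hf (congrFun (congrFun h PUnit.unit) PUnit.unit)⟩

section

variable (k : Type w) [Field k] {C : Type u₁} [Category.{v₁} C] [Preadditive C] [Linear k C]
  {D : Type u₂} [Category.{v₂} D] [Preadditive D] [Linear k D]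

/-- Over a field, a tensor product of vector spaces is nonzero iff both factors are. -/
theorem hasHom_linTensor_iff {X Y : LinTensor k C D} :
    HasHom X Y ↔ HasHom X.fst Y.fst ∧ HasHom X.snd Y.snd := by
  constructor
  · rintro ⟨f, hf⟩
    constructor
    · by_contra! h
      have h0 : ∀ a : X.fst ⟶ Y.fst, a = 0 := fun a => by_contra fun ha => h ⟨a, ha⟩
      refine hf (LinTensor.hom_induction (p := fun f => f = 0) f rfl (fun a b => ?_) ?_)
      · rw [h0 a]
        exact TensorProduct.zero_tmul _ _
      · rintro a b rfl rfl
        exact add_zero _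
    · by_contra! h
      have h0 : ∀ a : X.snd ⟶ Y.snd, a = 0 := fun a => by_contra fun ha => h ⟨a, ha⟩
      refine hf (LinTensor.hom_induction (p := fun f => f = 0) f rfl (fun a b => ?_) ?_)
      · rw [h0 b]
        exact TensorProduct.tmul_zero _ _
      · rintro a b rfl rfl
        exact add_zero _
  · rintro ⟨⟨f, hf⟩, ⟨g, hg⟩⟩
    have : Nontrivial (X.fst ⟶ Y.fst) := ⟨f, 0, hf⟩
    have : Nontrivial (X.snd ⟶ Y.snd) := ⟨g, 0, hg⟩
    have : Nontrivial (TensorProduct k (X.fst ⟶ Y.fst) (X.snd ⟶ Y.snd)) :=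
      Module.FaithfullyFlat.lTensor_nontrivial k _ _
    exact exists_ne (0 : TensorProduct k (X.fst ⟶ Y.fst) (X.snd ⟶ Y.snd))

theorem hasHom_box_iff {U X : C} {V Y : D} :
    HasHom (box k U V) (box k X Y) ↔ HasHom U X ∧ HasHom V Y :=
  hasHom_mat_iff.trans ⟨fun ⟨_, _, h⟩ => (hasHom_linTensor_iff k).1 h,
    fun h => ⟨PUnit.unit, PUnit.unit, (hasHom_linTensor_iff k).2 h⟩⟩

/-- The functor `X ↦ X ⊠ Y`. -/
def boxRight (Y : D) : C ⥤ LinTensor k C D where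
  obj X := ⟨X, Y⟩
  map f := LinTensor.tmul f (𝟙 Y)
  map_id _ := rfl
  map_comp f g := by rw [LinTensor.tmul_comp_tmul, Category.comp_id]

instance (Y : D) : (boxRight k Y : C ⥤ LinTensor k C D).Additive where
  map_add := TensorProduct.add_tmul _ _ _

/-- The functor `Y ↦ X ⊠ Y`. -/
def boxLeft (X : C) : D ⥤ LinTensor k C D where
  obj Y := ⟨X, Y⟩
  map f := LinTensor.tmul (𝟙 X) f
  map_id _ := rfl
  map_comp f g := by rw [LinTensor.tmul_comp_tmul, Category.comp_id]

instance (X : C) : (boxLeft k X : D ⥤ LinTensor k C D).Additive where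
  map_add := TensorProduct.tmul_add _ _ _

/-- The box is additive in each variable separately: expand `X` first, then `Y` in every resulting
summand. -/
theorem finiteSums_box [HasFiniteBiproducts C] [HasFiniteBiproducts D] {P : ObjectProperty C}
    {Q : ObjectProperty D} {X : C} {Y : D} (hX : finiteSums P X) (hY : finiteSums Q Y) :
    finiteSums (fun Z => ∃ U V, P U ∧ Q V ∧ Z = box k U V) (box k X Y) := by
  refine finiteSums_finiteSums (finiteSums_map (boxRight k Y ⋙ Mat_.embedding _) (fun U hU => ?_) hX)
  exact finiteSums_map (boxLeft k U ⋙ Mat_.embedding _) (fun V hV => ⟨U, V, hU, hV, rfl⟩) hY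

end

/-! ### Tensor products and duals of boxes -/

section Tensor

variable (k : Type w) [Field k] {C : Type u₁} [Category.{v₁} C] [Preadditive C] [Linear k C]
  [MonoidalCategory C] [MonoidalPreadditive C] [MonoidalLinear k C]
  {D : Type u₂} [Category.{v₂} D] [Preadditive D] [Linear k D]
  [MonoidalCategory D] [MonoidalPreadditive D] [MonoidalLinear k D]

theorem hasHom_box_tensor_iff {U X X' : C} {V Y Y' : D} :
    HasHom (box k U V) (box k X Y ⊗ box k X' Y') ↔ HasHom U (X ⊗ X') ∧ HasHom V (Y ⊗ Y') :=
  hasHom_mat_iff.trans ⟨fun ⟨_, _, h⟩ => (hasHom_linTensor_iff k).1 h,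
    fun h => ⟨PUnit.unit, (PUnit.unit, PUnit.unit), (hasHom_linTensor_iff k).2 h⟩⟩

theorem hasHom_tensor_box_unit_iff {X X' : C} {Y Y' : D} :
    HasHom (box k X Y ⊗ box k X' Y') (𝟙_ (DeligneProduct k C D)) ↔
      HasHom (X ⊗ X') (𝟙_ C) ∧ HasHom (Y ⊗ Y') (𝟙_ D) :=
  hasHom_mat_iff.trans ⟨fun ⟨_, _, h⟩ => (hasHom_linTensor_iff k).1 h,
    fun h => ⟨(PUnit.unit, PUnit.unit), PUnit.unit, (hasHom_linTensor_iff k).2 h⟩⟩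

theorem hasHom_box_unit_iff {X : C} {Y : D} :
    HasHom (box k X Y) (𝟙_ (DeligneProduct k C D)) ↔ HasHom X (𝟙_ C) ∧ HasHom Y (𝟙_ D) :=
  hasHom_mat_iff.trans ⟨fun ⟨_, _, h⟩ => (hasHom_linTensor_iff k).1 h,
    fun h => ⟨PUnit.unit, PUnit.unit, (hasHom_linTensor_iff k).2 h⟩⟩

/-- The duality between `(X, Y)` and `(X', Y')`, given dualities in both factors. -/
instance linTensorPairing (X X' : C) (Y Y' : D) [ExactPairing X X'] [ExactPairing Y Y'] :
    ExactPairing (⟨X, Y⟩ : LinTensor k C D) (⟨X', Y'⟩ : LinTensor k C D) where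
  coevaluation' := LinTensor.tmul (X := 𝟙_ (LinTensor k C D))
    (Y := (⟨X, Y⟩ : LinTensor k C D) ⊗ ⟨X', Y'⟩) (η_ X X') (η_ Y Y')
  evaluation' := LinTensor.tmul (Y := 𝟙_ (LinTensor k C D))
    (X := (⟨X', Y'⟩ : LinTensor k C D) ⊗ ⟨X, Y⟩) (ε_ X X') (ε_ Y Y')
  coevaluation_evaluation' := by
    refine (congrArg₂ (· ≫ ·) (LinTensor.tmul_tensor_tmul ..)
      (congrArg (_ ≫ ·) (LinTensor.tmul_tensor_tmul ..))).trans ?_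
    refine (congrArg (_ ≫ ·) (LinTensor.tmul_comp_tmul _ _ _ _)).trans ?_
    refine (LinTensor.tmul_comp_tmul _ _ _ _).trans
      (Eq.trans ?_ (LinTensor.tmul_comp_tmul _ _ _ _).symm)
    refine congrArg₂ LinTensor.tmul (Eq.trans ?_ (ExactPairing.coevaluation_evaluation X X'))
      (Eq.trans ?_ (ExactPairing.coevaluation_evaluation Y Y'))
    all_goals exact congrArg₂ (· ≫ ·) (id_tensorHom _ _) (congrArg (_ ≫ ·) (tensorHom_id _ _))
  evaluation_coevaluation' := by
    refine (congrArg₂ (· ≫ ·) (LinTensor.tmul_tensor_tmul ..)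
      (congrArg (_ ≫ ·) (LinTensor.tmul_tensor_tmul ..))).trans ?_
    refine (congrArg (_ ≫ ·) (LinTensor.tmul_comp_tmul _ _ _ _)).trans ?_
    refine (LinTensor.tmul_comp_tmul _ _ _ _).trans
      (Eq.trans ?_ (LinTensor.tmul_comp_tmul _ _ _ _).symm)
    refine congrArg₂ LinTensor.tmul (Eq.trans ?_ (ExactPairing.evaluation_coevaluation X X'))
      (Eq.trans ?_ (ExactPairing.evaluation_coevaluation Y Y'))
    all_goals exact congrArg₂ (· ≫ ·) (tensorHom_id _ _) (congrArg (_ ≫ ·) (id_tensorHom _ _))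

end Tensor

/-! ### Duals in the additive completion -/

section MatPairing

variable {A : Type u₁} [Category.{v₁} A] [Preadditive A] [MonoidalCategory A]
  [MonoidalPreadditive A]

open MatTensor

/-- A duality in `A` gives a duality in `Mat_ A`. -/
instance embeddingPairing (X Y : A) [ExactPairing X Y] :
    ExactPairing ((Mat_.embedding A).obj X) ((Mat_.embedding A).obj Y) where
  coevaluation' := reindex (M := 𝟙_ (Mat_ A))
    (N := tensorMat ((Mat_.embedding A).obj X) ((Mat_.embedding A).obj Y))
    (Equiv.punitProd PUnit.{1}).symm (fun _ => η_ X Y)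
  evaluation' := reindex (N := 𝟙_ (Mat_ A))
    (M := tensorMat ((Mat_.embedding A).obj Y) ((Mat_.embedding A).obj X))
    (Equiv.punitProd PUnit.{1}) (fun _ => ε_ X Y)
  coevaluation_evaluation' := by
    refine (congrArg₂ (· ≫ ·)
      ((congrArg (· ⊗ₘ _) (id_eq_reindex _)).trans (reindex_tensor_reindex _ _ _ _))
      (congrArg (_ ≫ ·)
        ((congrArg (_ ⊗ₘ ·) (id_eq_reindex _)).trans (reindex_tensor_reindex _ _ _ _)))).trans ?_
    refine (congrArg (_ ≫ ·) (reindex_comp_reindex _ _ _ _)).trans ?_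
    refine (reindex_comp_reindex _ _ _ _).trans
      (Eq.trans ?_ (reindex_comp_reindex _ _ _ _).symm)
    refine reindex_congr (fun _ => rfl) (fun p => (Category.comp_id _).trans ?_)
    have := ExactPairing.coevaluation_evaluation X Y
    refine Eq.trans ?_ (this.trans (congrArg (_ ≫ ·) (Category.id_comp _).symm))
    exact congrArg₂ (· ≫ ·) (id_tensorHom _ _) (congrArg₂ (· ≫ ·) (Category.id_comp _)
      (tensorHom_id _ _))
  evaluation_coevaluation' := by
    refine (congrArg₂ (· ≫ ·)
      ((congrArg (_ ⊗ₘ ·) (id_eq_reindex _)).trans (reindex_tensor_reindex _ _ _ _))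
      (congrArg (_ ≫ ·)
        ((congrArg (· ⊗ₘ _) (id_eq_reindex _)).trans (reindex_tensor_reindex _ _ _ _)))).trans ?_
    refine (congrArg (_ ≫ ·) (reindex_comp_reindex _ _ _ _)).trans ?_
    refine (reindex_comp_reindex _ _ _ _).trans
      (Eq.trans ?_ (reindex_comp_reindex _ _ _ _).symm)
    refine reindex_congr (fun _ => rfl) (fun p => (Category.comp_id _).trans ?_)
    have := ExactPairing.evaluation_coevaluation X Y
    refine Eq.trans ?_ (this.trans (congrArg (_ ≫ ·) (Category.id_comp _).symm))
    exact congrArg₂ (· ≫ ·) (tensorHom_id _ _) (congrArg (_ ≫ ·) (id_tensorHom _ _))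

end MatPairing

/-! ### Semisimplicity of Deligne's tensor product -/

section Semisimple

variable (k : Type w) [Field k] [IsAlgClosed k] 
  {C : Type u₁} [Category.{v₁} C] [Abelian C] [Linear k C]
  [MonoidalCategory C] [MonoidalPreadditive C] [MonoidalLinear k C] [RigidCategory C]
  [IsFusionCategory k C]
  {D : Type u₂} [Category.{v₂} D] [Abelian D] [Linear k D]
  [MonoidalCategory D] [MonoidalPreadditive D] [MonoidalLinear k D] [RigidCategory D]
  [IsFusionCategory k D]

/-- The object `X ⊠ Y` for simple `X` and `Y`. -/
def simpleBox (p : SimpleObj C × SimpleObj D) : DeligneProduct k C D := box k p.1.1 p.2.1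

/-- Algebraic closedness enters here: both factors have endomorphism ring `k`, so pure tensors, and
then their sums, are scalars. -/
theorem exists_smul_id_of_simple {X : LinTensor k C D} (hX : Simple X.fst) (hY : Simple X.snd)
    (f : X ⟶ X) : ∃ c : k, f = c • 𝟙 X := by
  have := IsFusionCategory.finiteDimensional_hom (k := k) X.fst X.fst
  have := IsFusionCategory.finiteDimensional_hom (k := k) X.snd X.snd
  induction f using LinTensor.hom_induction with
  | zero => exact ⟨0, (zero_smul _ _).symm⟩
  | tmul a b =>
    obtain ⟨c, rfl⟩ := endomorphism_simple_eq_smul_id k a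
    obtain ⟨d, rfl⟩ := endomorphism_simple_eq_smul_id k b
    exact ⟨c * d, TensorProduct.smul_tmul_smul c d (𝟙 X.fst) (𝟙 X.snd)⟩
  | add a b ha hb =>
    obtain ⟨c, rfl⟩ := ha
    obtain ⟨d, rfl⟩ := hb
    exact ⟨c + d, (add_smul _ _ _).symm⟩

-- Decompositions come from expanding each entry of the matrix object in both factors. Schur's lemma
-- holds because a nonzero map between boxes forces both factors to be isomorphic, after which it is
-- a nonzero scalar.
variable (C D) in
theorem simpleSystem_box :
    SimpleSystem (simpleBox k : SimpleObj C × SimpleObj D → DeligneProduct k C D) where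
  decomp M := by
    refine finiteSums_biproduct (fun i => ?_) (Mat_.isoBiproductEmbedding M)
    refine finiteSums_mono ?_ (finiteSums_box k (IsFusionCategory.semisimple k (M.X i).fst)
      (IsFusionCategory.semisimple k (M.X i).snd))
    rintro _ ⟨U, V, hU, hV, rfl⟩
    exact ⟨(⟨U, hU⟩, ⟨V, hV⟩), rfl⟩
  isIso {p q} f hf := by
    obtain ⟨h1, h2⟩ := (hasHom_box_iff k).1 ⟨f, hf⟩
    obtain ⟨e⟩ := (simpleSystem k C).iso_of_hasHom h1
    obtain ⟨e'⟩ := (simpleSystem k D).iso_of_hasHom h2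
    -- Composing `f` with the inverse of this reference isomorphism gives an endomorphism, to which
    -- the scalar lemma applies.
    let i : simpleBox k p ≅ simpleBox k q :=
      (Mat_.embedding (LinTensor k C D)).mapIso (LinTensor.mkIso e e')
    obtain ⟨g, hg⟩ := (Mat_.embedding (LinTensor k C D)).map_surjective (f ≫ i.inv)
    obtain ⟨c, rfl⟩ := exists_smul_id_of_simple k p.1.2 p.2.2 g
    have hc : c ≠ 0 := by
      rintro rfl
      rw [zero_smul, Functor.map_zero] at hg
      exact hf (zero_of_comp_mono i.inv hg.symm)
    have : IsIso (c • 𝟙 (⟨p.1.1, p.2.1⟩ : LinTensor k C D)) :=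
      ⟨c⁻¹ • 𝟙 _, by simp [smul_smul, hc], by simp [smul_smul, hc]⟩
    have : IsIso (f ≫ i.inv) :=
      (congrArg (fun g => IsIso g) hg).mp (inferInstanceAs (IsIso ((Mat_.embedding _).map _)))
    exact IsIso.of_isIso_comp_right f i.inv
  id_ne_zero p h := by
    obtain ⟨f, hf⟩ := (hasHom_box_iff k).2 ⟨(simpleSystem k C).hasHom_self p.1,
      (simpleSystem k D).hasHom_self p.2⟩
    exact hf ((Category.comp_id f).symm.trans ((congrArg (f ≫ ·) h).trans comp_zero))

variable {k} in
/-- The simple objects of a fusion subcategory of the Deligne product are stable under duality. -/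
theorem box_mem_iff_of_hasHom_unit {S : ObjectProperty (DeligneProduct k C D)}
    (hS : IsFusionSubcategory S) {X X' : SimpleObj C} {Y Y' : SimpleObj D}
    (h : HasHom (X.1 ⊗ X'.1) (𝟙_ C)) (h' : HasHom (Y.1 ⊗ Y'.1) (𝟙_ D)) :
    S (box k X.1 Y.1) ↔ S (box k X'.1 Y'.1) := by
  -- Duals of boxes are formed factorwise: a left dual for the first box, a right dual for the
  -- second.
  let _ : ExactPairing (box k (ᘁX.1) (ᘁY.1)) (simpleBox k (X, Y)) :=
    embeddingPairing (⟨ᘁX.1, ᘁY.1⟩ : LinTensor k C D) ⟨X.1, Y.1⟩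
  let _ : ExactPairing (simpleBox k (X', Y')) (box k (X'.1)ᘁ (Y'.1)ᘁ) :=
    embeddingPairing (⟨X'.1, Y'.1⟩ : LinTensor k C D) ⟨(X'.1)ᘁ, (Y'.1)ᘁ⟩
  exact (simpleSystem_box k C D).mem_iff_of_hasHom_unit (i := (X, Y)) (j := (X', Y'))
    (L := box k (ᘁX.1) (ᘁY.1)) (R := box k (X'.1)ᘁ (Y'.1)ᘁ) hS
    ((hasHom_tensor_box_unit_iff k).2 ⟨h, h'⟩)

end Semisimple

/-! ### Gradings -/

section Gradings

variable (k : Type w) [Field k] {C : Type u₁} [Category.{v₁} C] [Abelian C] [Linear k C]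
  [MonoidalCategory C] [MonoidalPreadditive C] [MonoidalLinear k C] [RigidCategory C]
  [IsFusionCategory k C] {E : ObjectProperty C} {G : Type t} [Group G]

namespace Grading

/-- The degree of a simple object. -/
def degree (γ : Grading E G) (X : SimpleObj C) (h : E X.1) : G :=
  γ.deg (SimpleClasses.mk X.1 X.2 h)

variable (γ : Grading E G)

omit [MonoidalPreadditive C] [RigidCategory C] in
theorem degree_congr {X Y : SimpleObj C} (hX : E X.1) (hY : E Y.1) (h : HasHom X.1 Y.1) :
    γ.degree X hX = γ.degree Y hY := by
  obtain ⟨f, hf⟩ := h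
  have := X.2
  have := Y.2
  have := isIso_of_hom_simple hf
  exact congrArg γ.deg (Quotient.sound ⟨(simplesIn E).isoMk (asIso f)⟩)

omit [MonoidalPreadditive C] [RigidCategory C] in
theorem degree_tensor {X Y Z : SimpleObj C} (hX : E X.1) (hY : E Y.1) (hZ : E Z.1)
    (h : HasHom Z.1 (X.1 ⊗ Y.1)) : γ.degree Z hZ = γ.degree X hX * γ.degree Y hY := by
  obtain ⟨f, hf⟩ := h
  have := Z.2
  exact γ.deg_mul X.2 Y.2 Z.2 hX hY hZ ⟨f, mono_of_nonzero_from_simple hf⟩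

-- Here `X ≅ X ⊗ X`, so the degree of `X` is idempotent in a group.
include k in
theorem degree_unit {X : SimpleObj C} (hX : E X.1) (h : HasHom X.1 (𝟙_ C)) :
    γ.degree X hX = 1 := by
  obtain ⟨e⟩ := (simpleSystem k C).iso_of_hasHom (i := X) (j := unitObj k C) h
  have e' : X.1 ≅ X.1 ⊗ X.1 := (ρ_ X.1).symm ≪≫ whiskerLeftIso X.1 e.symm
  have := γ.degree_tensor hX hX hX
    ((HasHom.congr (Iso.refl _) e').1 ((simpleSystem k C).hasHom_self X))
  exact left_eq_mul.1 this

-- The unit is a constituent of `X ⊗ Y` and has degree `1`.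
include k in
theorem degree_dual (hE : IsFusionSubcategory E) {X Y : SimpleObj C} (hX : E X.1) (hY : E Y.1)
    (h : HasHom (X.1 ⊗ Y.1) (𝟙_ C)) : γ.degree X hX * γ.degree Y hY = 1 := by
  rw [← γ.degree_tensor (Z := unitObj k C) hX hY hE.unit
    (((simpleSystem k C).hasHom_comm (i := unitObj k C)).2 h)]
  exact γ.degree_unit k _ ((simpleSystem k C).hasHom_self (unitObj k C))

omit [MonoidalPreadditive C] [RigidCategory C] in
theorem exists_degree_eq {γ : Grading E G} (h : γ.IsFaithful) (g : G) :
    ∃ (X : SimpleObj C) (hX : E X.1), γ.degree X hX = g := by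
  obtain ⟨⟨X, hX, hE⟩, hg⟩ := h g
  exact ⟨⟨X, hX⟩, hE, hg⟩

include k in
theorem degree_of_hasHom_component {g : G} {M : C} (hM : γ.component g M) {X : SimpleObj C}
    (hE : IsFusionSubcategory E) (h : HasHom X.1 M) : ∃ hX : E X.1, γ.degree X hX = g := by
  obtain ⟨n, W, hW, ⟨e⟩⟩ := hM
  obtain ⟨j, hj⟩ := hasHom_biproduct_right.1 ((HasHom.congr (Iso.refl _) e).1 h)
  obtain ⟨hY, eY, rfl⟩ := hW j
  have hX := (simpleSystem k C).mem_of_hasHom hE hj eY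
  exact ⟨hX, γ.degree_congr (Y := ⟨W j, hY⟩) hX eY hj⟩

/-- A grading from a degree function on simple objects. -/
def ofDegree (d : ∀ X : SimpleObj C, E X.1 → G)
    (congr : ∀ X Y hX hY, Nonempty (X.1 ≅ Y.1) → d X hX = d Y hY)
    (tensor : ∀ X Y Z hX hY hZ, HasHom Z.1 (X.1 ⊗ Y.1) → d Z hZ = d X hX * d Y hY) :
    Grading E G where
  deg := Quotient.lift (fun X => d ⟨X.obj, X.property.1⟩ X.property.2) fun X Y ⟨e⟩ =>
    congr _ _ _ _ ⟨(simplesIn E).ι.mapIso e⟩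
  deg_mul {X Y Z} hX hY hZ eX eY eZ := fun ⟨i, _⟩ =>
    tensor ⟨X, hX⟩ ⟨Y, hY⟩ ⟨Z, hZ⟩ eX eY eZ ⟨i, fun h => id_nonzero Z (zero_of_comp_mono i
      (by rw [h, comp_zero]))⟩

end Grading

end Gradings

/-! ### Fusion relations and difunctionality -/

section Relations

variable (k : Type w) [Field k] {C : Type u₁} [Category.{v₁} C] [Abelian C] [Linear k C]
  [MonoidalCategory C] [MonoidalPreadditive C] [MonoidalLinear k C] [RigidCategory C]
  [IsFusionCategory k C]
  {D : Type u₂} [Category.{v₂} D] [Abelian D] [Linear k D]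
  [MonoidalCategory D] [MonoidalPreadditive D] [MonoidalLinear k D] [RigidCategory D]
  [IsFusionCategory k D]

/-- A relation between simple objects of `C` and of `D` compatible with units, tensor products and
duals; it is the same thing as a fusion subcategory of `C ⊠ D`. -/
structure IsFusionRelation (T : SimpleObj C → SimpleObj D → Prop) : Prop where
  unit : ∀ {X Y}, HasHom X.1 (𝟙_ C) → HasHom Y.1 (𝟙_ D) → T X Y
  tensor : ∀ {X Y X' Y' X'' Y''}, T X Y → T X' Y' → HasHom X''.1 (X.1 ⊗ X'.1) →
    HasHom Y''.1 (Y.1 ⊗ Y'.1) → T X'' Y''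
  dual : ∀ {X Y X' Y'}, HasHom (X.1 ⊗ X'.1) (𝟙_ C) → HasHom (Y.1 ⊗ Y'.1) (𝟙_ D) →
    (T X Y ↔ T X' Y')

namespace IsFusionRelation

variable {T : SimpleObj C → SimpleObj D → Prop} (hT : IsFusionRelation T)

include hT

-- The axioms are symmetric in the two categories, so statements proved for `C` transfer to `D`.
omit [MonoidalPreadditive C] [RigidCategory C] [MonoidalPreadditive D] [RigidCategory D] in
theorem swap : IsFusionRelation (fun Y X => T X Y) where
  unit h h' := hT.unit h' h
  tensor h h' h'' h''' := hT.tensor h h' h''' h''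
  dual h h' := hT.dual h' h

include k

/-- Invariance under isomorphism is not an axiom; it follows by tensoring with the pair of units. -/
theorem congr {X X' : SimpleObj C} {Y Y' : SimpleObj D} (h : T X Y) (e : HasHom X'.1 X.1)
    (e' : HasHom Y'.1 Y.1) : T X' Y' :=
  hT.tensor (X' := unitObj k C) (Y' := unitObj k D) h
    (hT.unit ((simpleSystem k C).hasHom_self (unitObj k C))
      ((simpleSystem k D).hasHom_self (unitObj k D)))
    ((HasHom.congr (Iso.refl _) (ρ_ X.1)).2 e) ((HasHom.congr (Iso.refl _) (ρ_ Y.1)).2 e')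

/-- The relation is difunctional. -/
theorem difunctional {X X' : SimpleObj C} {Y Y' : SimpleObj D} (h : T X Y) (h₁ : T X' Y)
    (h₂ : T X Y') : T X' Y' := by
  obtain ⟨X₀, hX₀, hX₀'⟩ := exists_dual k X
  obtain ⟨Y₀, hY₀, -⟩ := exists_dual k Y
  have h₀ : T X₀ Y₀ := (hT.dual hX₀ hY₀).1 h
  obtain ⟨W, hW, hW'⟩ := exists_intermediate k X' X₀ X hX₀'
  -- `W` lies in `X' ⊗ X₀` and the unit lies in `Y ⊗ Y₀`.
  have h₃ : T W (unitObj k D) := hT.tensor h₁ h₀ hW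
    (((simpleSystem k D).hasHom_comm (i := unitObj k D)).2 hY₀)
  exact hT.tensor h₃ h₂ hW'
    ((HasHom.congr (Iso.refl _) (λ_ Y'.1)).2 ((simpleSystem k D).hasHom_self Y'))

theorem isFusionSubcategory_left :
    IsFusionSubcategory (supported (Subtype.val : SimpleObj C → C) fun X => ∃ Y, T X Y) := by
  refine (simpleSystem k C).isFusionSubcategory_supported ?_ ?_ ?_
  · exact fun X hX => ⟨unitObj k D, hT.unit hX ((simpleSystem k D).hasHom_self (unitObj k D))⟩
  · rintro X X' X'' ⟨Y, h⟩ ⟨Y', h'⟩ hX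
    obtain ⟨Y₁, hY₁, -⟩ := exists_dual k Y'
    -- Only the existence of a simple constituent of `Y ⊗ Y'` matters; it serves as the partner of
    -- `X''`.
    obtain ⟨W, hW, -⟩ := exists_intermediate k Y Y' Y₁ hY₁
    exact ⟨W, hT.tensor h h' hX hW⟩
  · refine fun X X' hX => ⟨?_, ?_⟩
    · rintro ⟨Y, h⟩
      obtain ⟨Y', hY', -⟩ := exists_dual k Y
      exact ⟨Y', (hT.dual hX hY').1 h⟩
    · rintro ⟨Y, h⟩
      obtain ⟨Y', -, hY'⟩ := exists_dual k Y
      exact ⟨Y', (hT.dual hX hY').2 h⟩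

theorem mem_left_iff {X : SimpleObj C} :
    supported (Subtype.val : SimpleObj C → C) (fun X => ∃ Y, T X Y) X.1 ↔ ∃ Y, T X Y := by
  refine ⟨fun h => h X ((simpleSystem k C).hasHom_self X), ?_⟩
  rintro ⟨Y, h⟩ X' hX'
  exact ⟨Y, hT.congr k h hX' ((simpleSystem k D).hasHom_self Y)⟩

variable [IsAlgClosed k]

theorem isFusionSubcategory_box :
    IsFusionSubcategory (supported (simpleBox k) fun p => T p.1 p.2) := by
  refine (simpleSystem_box k C D).isFusionSubcategory_supported ?_ ?_ ?_
  · intro p hp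
    obtain ⟨h, h'⟩ := (hasHom_box_unit_iff k).1 hp
    exact hT.unit h h'
  · intro p q r hp hq hr
    obtain ⟨h, h'⟩ := (hasHom_box_tensor_iff k).1 hr
    exact hT.tensor hp hq h h'
  · intro p q h
    obtain ⟨h, h'⟩ := (hasHom_tensor_box_unit_iff k).1 h
    exact hT.dual h h'

theorem mem_box_iff {X : SimpleObj C} {Y : SimpleObj D} :
    supported (simpleBox k) (fun p => T p.1 p.2) (box k X.1 Y.1) ↔ T X Y := by
  refine ⟨fun h => h (X, Y) ((simpleSystem_box k C D).hasHom_self (X, Y)), fun h p hp => ?_⟩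
  obtain ⟨h₁, h₂⟩ := (hasHom_box_iff k).1 hp
  exact hT.congr k h h₁ h₂

end IsFusionRelation

/-- The simple objects of a fusion subcategory of `C ⊠ D` form a fusion relation. -/
theorem IsFusionSubcategory.isFusionRelation [IsAlgClosed k]
    {S : ObjectProperty (DeligneProduct k C D)} (hS : IsFusionSubcategory S) :
    IsFusionRelation (fun (X : SimpleObj C) (Y : SimpleObj D) => S (box k X.1 Y.1)) where
  unit {X Y} h h' := (simpleSystem_box k C D).mem_of_hasHom (i := (X, Y)) hS
    ((hasHom_box_unit_iff k).2 ⟨h, h'⟩) hS.unit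
  tensor {_ _ _ _ X Y} h h' h₁ h₂ := (simpleSystem_box k C D).mem_of_hasHom (i := (X, Y)) hS
    ((hasHom_box_tensor_iff k).2 ⟨h₁, h₂⟩) (hS.tensor h h')
  dual h h' := box_mem_iff_of_hasHom_unit hS h h'

end Relations

/-! ### From a subcategory datum to its relation and back -/

section Data

variable (k : Type w) [Field k] {C : Type u₁} [Category.{v₁} C] [Abelian C] [Linear k C]
  [MonoidalCategory C] [MonoidalPreadditive C] [MonoidalLinear k C] [RigidCategory C]
  [IsFusionCategory k C]
  {D : Type u₂} [Category.{v₂} D] [Abelian D] [Linear k D]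
  [MonoidalCategory D] [MonoidalPreadditive D] [MonoidalLinear k D] [RigidCategory D]
  [IsFusionCategory k D]

namespace SubcategoryDatum

variable (d d' : SubcategoryDatum.{v₁, v₂, u₁, u₂, t} C D)

/-- The relation `deg X = deg Y` between simple objects of `E` and `F`. -/
def rel (X : SimpleObj C) (Y : SimpleObj D) : Prop :=
  ∃ (hX : d.E X.1) (hY : d.F Y.1), d.gradE.degree X hX = d.gradF.degree Y hY

-- Units have degree `1`, degrees multiply along constituents, and dual simple objects have inverse
-- degrees, so equality of degrees is preserved.
include k in
theorem isFusionRelation_rel : IsFusionRelation d.rel where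
  unit {X Y} h h' := by
    have hX : d.E X.1 := (simpleSystem k C).mem_of_hasHom d.fusion_E h d.fusion_E.unit
    have hY : d.F Y.1 := (simpleSystem k D).mem_of_hasHom d.fusion_F h' d.fusion_F.unit
    exact ⟨hX, hY, (d.gradE.degree_unit k hX h).trans (d.gradF.degree_unit k hY h').symm⟩
  tensor := by
    rintro X Y X' Y' X'' Y'' ⟨hX, hY, h⟩ ⟨hX', hY', h'⟩ h₁ h₂
    have hX'' := (simpleSystem k C).mem_of_hasHom d.fusion_E h₁ (d.fusion_E.tensor hX hX')
    have hY'' := (simpleSystem k D).mem_of_hasHom d.fusion_F h₂ (d.fusion_F.tensor hY hY')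
    refine ⟨hX'', hY'', ?_⟩
    rw [d.gradE.degree_tensor hX hX' hX'' h₁, d.gradF.degree_tensor hY hY' hY'' h₂, h, h']
  dual {X Y X' Y'} h h' := by
    have hE := (simpleSystem k C).mem_iff_of_hasHom_unit (L := ᘁX.1) (R := (X'.1)ᘁ) d.fusion_E h
    have hF := (simpleSystem k D).mem_iff_of_hasHom_unit (L := ᘁY.1) (R := (Y'.1)ᘁ) d.fusion_F h'
    constructor
    · rintro ⟨hX, hY, e⟩
      refine ⟨hE.1 hX, hF.1 hY, ?_⟩
      rw [eq_inv_of_mul_eq_one_right (d.gradE.degree_dual k d.fusion_E hX (hE.1 hX) h), e,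
        eq_inv_of_mul_eq_one_right (d.gradF.degree_dual k d.fusion_F hY (hF.1 hY) h')]
    · rintro ⟨hX, hY, e⟩
      refine ⟨hE.2 hX, hF.2 hY, ?_⟩
      rw [eq_inv_of_mul_eq_one_left (d.gradE.degree_dual k d.fusion_E (hE.2 hX) hX h), e,
        eq_inv_of_mul_eq_one_left (d.gradF.degree_dual k d.fusion_F (hF.2 hY) hY h')]

-- Faithfulness of the grading on the other side, `F`, supplies a partner of the same degree.
omit [MonoidalPreadditive C] [RigidCategory C] [MonoidalPreadditive D] [RigidCategory D] in
theorem mem_E_iff {X : SimpleObj C} : d.E X.1 ↔ ∃ Y, d.rel X Y := by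
  refine ⟨fun hX => ?_, fun ⟨_, hX, _⟩ => hX⟩
  obtain ⟨Y, hY, h⟩ := Grading.exists_degree_eq d.faithful_F (d.gradE.degree X hX)
  exact ⟨Y, hX, hY, h.symm⟩

omit [MonoidalPreadditive C] [RigidCategory C] [MonoidalPreadditive D] [RigidCategory D] in
theorem mem_F_iff {Y : SimpleObj D} : d.F Y.1 ↔ ∃ X, d.rel X Y := by
  refine ⟨fun hY => ?_, fun ⟨_, _, hY, _⟩ => hY⟩
  obtain ⟨X, hX, h⟩ := Grading.exists_degree_eq d.faithful_E (d.gradF.degree Y hY)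
  exact ⟨X, hX, hY, h⟩

omit [Linear k D] [MonoidalPreadditive D] [MonoidalLinear k D] [RigidCategory D]
  [IsFusionCategory k D] in
include k in
theorem E_eq : d.E = supported (Subtype.val : SimpleObj C → C) fun X => ∃ Y, d.rel X Y := by
  rw [← (simpleSystem k C).supported_eq d.fusion_E]
  exact congrArg _ (funext fun X => propext d.mem_E_iff)

omit [Linear k C] [MonoidalPreadditive C] [MonoidalLinear k C] [RigidCategory C]
  [IsFusionCategory k C] in
include k in
theorem F_eq : d.F = supported (Subtype.val : SimpleObj D → D) fun Y => ∃ X, d.rel X Y := by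
  rw [← (simpleSystem k D).supported_eq d.fusion_F]
  exact congrArg _ (funext fun Y => propext d.mem_F_iff)

variable [IsAlgClosed k]

/-- The fiber product is the full subcategory whose simple objects are the `X ⊠ Y` with
`deg X = deg Y`. -/
theorem fiberProduct_eq_supported :
    d.fiberProduct k = supported (simpleBox k) fun p => d.rel p.1 p.2 := by
  funext M
  refine propext ⟨?_, fun h => ?_⟩
  · rintro ⟨W, hW, ⟨e⟩⟩ p hp
    obtain ⟨g, hg⟩ := hasHom_biproduct_right.1 ((HasHom.congr (Iso.refl _) e).1 hp)
    obtain ⟨n, V, hV, ⟨e'⟩⟩ := hW g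
    obtain ⟨j, hj⟩ := hasHom_biproduct_right.1 ((HasHom.congr (Iso.refl _) e').1 hg)
    obtain ⟨X, Y, hX, hY, h⟩ := hV j
    rw [h] at hj
    obtain ⟨h₁, h₂⟩ := (hasHom_box_iff k).1 hj
    obtain ⟨hE, h₁⟩ := d.gradE.degree_of_hasHom_component k hX d.fusion_E h₁
    obtain ⟨hF, h₂⟩ := d.gradF.degree_of_hasHom_component k hY d.fusion_F h₂
    exact ⟨hE, hF, h₁.trans h₂.symm⟩
  · obtain ⟨n, W, hW, ⟨e⟩⟩ := (simpleSystem_box k C D).decomp_constituents M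
    choose p hp hp' using hW
    have hrel := fun j => h (p j) (hp' j)
    choose hE hF hdeg using hrel
    -- The summands of `M` are sorted by their common degree; the fiber of `g` over `x` gives the
    -- component at `x`.
    let g : Fin n → d.G := fun j => d.gradE.degree (p j).1 (hE j)
    refine ⟨fun x => ⨁ fun j : {j // g j = x} => W j, fun x => ?_, ⟨e ≪≫ ?_⟩⟩
    · refine finiteSums_of_finite (J := {j // g j = x}) (fun j => ?_) (Iso.refl _)
      refine ⟨(p j).1.1, (p j).2.1, finiteSums_of_mem ⟨(p j).1.2, hE j, j.2⟩,
        finiteSums_of_mem ⟨(p j).2.2, hF j, (hdeg j).symm.trans j.2⟩, hp j⟩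
    · exact biproduct.whiskerEquiv (f := W) (g := fun q : Σ x, {j // g j = x} => W q.2)
        (Equiv.sigmaFiberEquiv g).symm (fun j => Iso.refl _) ≪≫
        (biproductBiproductIso (fun x => {j // g j = x}) fun x j => W j).symm

variable {d d'} in
theorem rel_eq_of_fiberProduct_eq (h : d.fiberProduct k = d'.fiberProduct k) : d.rel = d'.rel := by
  funext X Y
  rw [← (d.isFusionRelation_rel k).mem_box_iff k, ← (d'.isFusionRelation_rel k).mem_box_iff k,
    ← fiberProduct_eq_supported, ← fiberProduct_eq_supported, h]

-- Send `g` to the new degree of a chosen simple object `X g` of old degree `g`. Related objects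
-- have equal new degrees, so this is correct on `F`, each `Y` being related to `X (deg Y)`. A
-- simple object of `E` is then compared with `X g` through a partner in `F`.
omit [MonoidalPreadditive C] [RigidCategory C] [MonoidalPreadditive D] [RigidCategory D]
  [IsAlgClosed k] in
variable {d d'} in
theorem exists_map_of_rel_eq (h : d.rel = d'.rel) : ∃ f : d.G → d'.G,
    (∀ X hX hX', d'.gradE.degree X hX' = f (d.gradE.degree X hX)) ∧
      ∀ Y hY hY', d'.gradF.degree Y hY' = f (d.gradF.degree Y hY) := by
  choose X hX hdeg using fun g => Grading.exists_degree_eq d.faithful_E g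
  have hX' (g) : d'.E (X g).1 := by
    rw [d'.mem_E_iff, ← h, ← d.mem_E_iff]
    exact hX g
  have key {Z : SimpleObj C} {Y : SimpleObj D} (hZ : d'.E Z.1) (hY : d'.F Y.1) (hr : d.rel Z Y) :
      d'.gradE.degree Z hZ = d'.gradF.degree Y hY := by
    rw [h] at hr
    obtain ⟨_, _, hr⟩ := hr
    exact hr
  have keyF (Y hY hY') : d'.gradF.degree Y hY' =
      d'.gradE.degree (X (d.gradF.degree Y hY)) (hX' _) :=
    (key _ _ ⟨hX _, hY, hdeg _⟩).symm
  refine ⟨fun g => d'.gradE.degree (X g) (hX' g), fun Z hZ hZ' => ?_, keyF⟩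
  obtain ⟨Y, hY, hYZ⟩ := Grading.exists_degree_eq d.faithful_F (d.gradE.degree Z hZ)
  have hY' : d'.F Y.1 := by
    rw [d'.mem_F_iff, ← h, ← d.mem_F_iff]
    exact hY
  rw [key hZ' hY' ⟨hZ, hY, hYZ.symm⟩, keyF Y hY hY', hYZ]

-- The degree-translating maps obtained in the two directions are mutually inverse by faithfulness.
-- Multiplicativity is read off from a constituent of a tensor product.
omit [IsAlgClosed k] in
include k in
variable {d d'} in
theorem equivalent_of_rel_eq (h : d.rel = d'.rel) : d ≈ d' := by
  have hE : d.E = d'.E := by rw [E_eq k d, E_eq k d', h]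
  have hF : d.F = d'.F := by rw [F_eq k d, F_eq k d', h]
  obtain ⟨f, hf, hf'⟩ := exists_map_of_rel_eq h
  obtain ⟨f', hf₁, hf₁'⟩ := exists_map_of_rel_eq h.symm
  have inv₁ (g) : f' (f g) = g := by
    obtain ⟨X, hX, rfl⟩ := Grading.exists_degree_eq d.faithful_E g
    rw [← hf X hX (hE ▸ hX), ← hf₁ X _ hX]
  have inv₂ (g) : f (f' g) = g := by
    obtain ⟨X, hX, rfl⟩ := Grading.exists_degree_eq d'.faithful_E g
    rw [← hf₁ X hX (hE ▸ hX), ← hf X _ hX]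
  let α : d.G ≃* d'.G :=
    { toFun := f
      invFun := f'
      left_inv := inv₁
      right_inv := inv₂
      map_mul' := fun g g' => by
        obtain ⟨X, hX, rfl⟩ := Grading.exists_degree_eq d.faithful_E g
        obtain ⟨X', hX', rfl⟩ := Grading.exists_degree_eq d.faithful_E g'
        obtain ⟨Y, hY, -⟩ := exists_dual k X'
        obtain ⟨Z, hZ, -⟩ := exists_intermediate k X X' Y hY
        have hZ' := (simpleSystem k C).mem_of_hasHom d.fusion_E hZ (d.fusion_E.tensor hX hX')
        rw [← d.gradE.degree_tensor hX hX' hZ' hZ, ← hf X hX (hE ▸ hX), ← hf X' hX' (hE ▸ hX'),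
          ← hf Z hZ' (hE ▸ hZ')]
        exact d'.gradE.degree_tensor _ _ _ hZ }
  -- Components are generated by their simple objects, so it suffices to match the generators of
  -- degree `g` with those of degree `α g`.
  refine ⟨hE, hF, α, fun g => ⟨congrArg finiteSums ?_, congrArg finiteSums ?_⟩⟩
  · funext X
    refine propext (exists_congr fun hX => ⟨?_, ?_⟩)
    · rintro ⟨eX, rfl⟩
      exact ⟨hE ▸ eX, hf ⟨X, hX⟩ eX _⟩
    · rintro ⟨eX, h⟩
      have eX' : d.E X := hE ▸ eX
      exact ⟨eX', α.injective ((hf ⟨X, hX⟩ eX' eX).symm.trans h)⟩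
  · funext Y
    refine propext (exists_congr fun hY => ⟨?_, ?_⟩)
    · rintro ⟨eY, rfl⟩
      exact ⟨hF ▸ eY, hf' ⟨Y, hY⟩ eY _⟩
    · rintro ⟨eY, h⟩
      have eY' : d.F Y := hF ▸ eY
      exact ⟨eY', α.injective ((hf' ⟨Y, hY⟩ eY' eY).symm.trans h)⟩

end SubcategoryDatum

end Data

/-! ### The datum of a fusion relation -/

section Quotient

variable (k : Type w) [Field k] {C : Type u₁} [Category.{v₁} C] [Abelian C] [Linear k C]
  [MonoidalCategory C] [MonoidalPreadditive C] [MonoidalLinear k C] [RigidCategory C]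
  [IsFusionCategory k C]
  {D : Type u₂} [Category.{v₂} D] [Abelian D] [Linear k D]
  [MonoidalCategory D] [MonoidalPreadditive D] [MonoidalLinear k D] [RigidCategory D]
  [IsFusionCategory k D] {T : SimpleObj C → SimpleObj D → Prop}

-- `X` embeds in `(X ⊗ Y) ⊗ Y'` for a dual `Y'` of `Y`, so `X ⊗ Y` cannot vanish.
include k in
theorem exists_constituent_tensor (X Y : SimpleObj C) :
    ∃ Z : SimpleObj C, HasHom Z.1 (X.1 ⊗ Y.1) := by
  obtain ⟨Y', hY, -⟩ := exists_dual k Y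
  obtain ⟨Z, hZ, -⟩ := exists_intermediate k X Y Y' hY
  exact ⟨Z, hZ⟩

namespace IsFusionRelation

variable (hT : IsFusionRelation T)

include k in
/-- Simple objects of `C` are equivalent if they are related to a common simple object of `D`. -/
def setoid : Setoid {X : SimpleObj C // ∃ Y, T X Y} where
  r X X' := ∃ Y, T X.1 Y ∧ T X'.1 Y
  iseqv :=
    { refl := fun X => X.2.imp fun _ h => ⟨h, h⟩
      symm := fun ⟨Y, h, h'⟩ => ⟨Y, h', h⟩
      -- Transitivity is exactly difunctionality: the first common partner is also one for the third
      -- object.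
      trans := fun ⟨Y, h, h'⟩ ⟨_, h₁, h₁'⟩ => ⟨Y, h, hT.difunctional k h₁ h₁' h'⟩ }

/-- The group of classes of related simple objects. -/
def GroupOf : Type u₁ := Quotient (hT.setoid k)

/-- The class of a simple object. -/
def cls (X : SimpleObj C) (h : ∃ Y, T X Y) : hT.GroupOf k := Quotient.mk _ ⟨X, h⟩

theorem cls_eq_iff {X X' : SimpleObj C} {h h'} :
    hT.cls k X h = hT.cls k X' h' ↔ ∃ Y, T X Y ∧ T X' Y :=
  Quotient.eq (r := hT.setoid k)

theorem exists_cls_eq (g : hT.GroupOf k) : ∃ X h, hT.cls k X h = g := by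
  obtain ⟨⟨X, h⟩, rfl⟩ := Quotient.exists_rep g
  exact ⟨X, h, rfl⟩

omit [Linear k C] [MonoidalPreadditive C] [MonoidalLinear k C] [RigidCategory C]
  [IsFusionCategory k C] in
include hT k in
theorem exists_tensor {X X' X'' : SimpleObj C} (h : ∃ Y, T X Y) (h' : ∃ Y, T X' Y)
    (h'' : HasHom X''.1 (X.1 ⊗ X'.1)) : ∃ Y, T X'' Y := by
  obtain ⟨Y, h⟩ := h
  obtain ⟨Y', h'⟩ := h'
  obtain ⟨Y'', hY⟩ := exists_constituent_tensor k Y Y'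
  exact ⟨Y'', hT.tensor h h' h'' hY⟩

/-- The product is the class of an arbitrary constituent of `X ⊗ X'`. It is well defined because a
constituent of `Y ⊗ Y'` is a common partner of all constituents obtained from objects with partners
`Y` and `Y'`. -/
instance : Mul (hT.GroupOf k) where
  mul := Quotient.map₂ (fun X X' => ⟨(exists_constituent_tensor k X.1 X'.1).choose,
    hT.exists_tensor k X.2 X'.2 (exists_constituent_tensor k X.1 X'.1).choose_spec⟩) <| by
      rintro X₁ X₂ ⟨Y, h₁, h₂⟩ X₁' X₂' ⟨Y', h₁', h₂'⟩
      obtain ⟨Y'', hY⟩ := exists_constituent_tensor k Y Y'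
      exact ⟨Y'', hT.tensor h₁ h₁' (exists_constituent_tensor k X₁.1 X₁'.1).choose_spec hY,
        hT.tensor h₂ h₂' (exists_constituent_tensor k X₂.1 X₂'.1).choose_spec hY⟩

/-- Every constituent of `X ⊗ X'` shares a partner with the chosen one; this is the grading property
of `cls`. -/
theorem cls_tensor {X X' X'' : SimpleObj C} {h h' h''} (hX : HasHom X''.1 (X.1 ⊗ X'.1)) :
    hT.cls k X'' h'' = hT.cls k X h * hT.cls k X' h' := by
  obtain ⟨Y, hY⟩ := h
  obtain ⟨Y', hY'⟩ := h'
  obtain ⟨Y'', hY''⟩ := exists_constituent_tensor k Y Y'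
  exact (hT.cls_eq_iff k).2 ⟨Y'', hT.tensor hY hY' hX hY'',
    hT.tensor hY hY' (exists_constituent_tensor k X X').choose_spec hY''⟩

include hT k in
theorem exists_unit : ∃ Y, T (unitObj k C) Y :=
  ⟨unitObj k D, hT.unit ((simpleSystem k C).hasHom_self (unitObj k C))
    ((simpleSystem k D).hasHom_self (unitObj k D))⟩

instance : One (hT.GroupOf k) where
  one := hT.cls k (unitObj k C) (hT.exists_unit k)

theorem exists_inv (g : hT.GroupOf k) : ∃ g' : hT.GroupOf k, g' * g = 1 := by
  obtain ⟨X, ⟨Y, h⟩, rfl⟩ := hT.exists_cls_eq k g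
  obtain ⟨X', -, hX'⟩ := exists_dual k X
  obtain ⟨Y', -, hY'⟩ := exists_dual k Y
  exact ⟨hT.cls k X' ⟨Y', (hT.dual hX' hY').2 h⟩, (hT.cls_tensor k
    (((simpleSystem k C).hasHom_comm (i := unitObj k C)).2 hX')).symm⟩

instance : Inv (hT.GroupOf k) where
  inv g := (hT.exists_inv k g).choose

/-- One simple object `U` is a constituent of both bracketings, by the associator, and its class
equals both products. -/
theorem mul_assoc_cls (a b c : hT.GroupOf k) : a * b * c = a * (b * c) := by
  obtain ⟨X, hX, rfl⟩ := hT.exists_cls_eq k a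
  obtain ⟨Y, hY, rfl⟩ := hT.exists_cls_eq k b
  obtain ⟨Z, hZ, rfl⟩ := hT.exists_cls_eq k c
  have hs := simpleSystem k C
  obtain ⟨V, hV⟩ := exists_constituent_tensor k X Y
  obtain ⟨U, hU⟩ := exists_constituent_tensor k V Z
  have hV' := hT.exists_tensor k hX hY hV
  have hU' := hT.exists_tensor k hV' hZ hU
  rw [← hT.cls_tensor k (h'' := hV') hV, ← hT.cls_tensor k (h'' := hU') hU]
  obtain ⟨f, hf⟩ := hV
  obtain ⟨r, hr⟩ := hs.exists_retraction f hf
  have : IsSplitMono (f ▷ Z.1) := IsSplitMono.mk' ⟨r ▷ Z.1, by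
    rw [← MonoidalCategory.comp_whiskerRight, hr, id_whiskerRight]⟩
  have h₁ : HasHom U.1 (X.1 ⊗ (Y.1 ⊗ Z.1)) :=
    (hU.comp_mono (f ▷ Z.1)).comp_mono (α_ X.1 Y.1 Z.1).hom
  obtain ⟨_, _, rfl, ⟨W, rfl, hW⟩, h₂⟩ := HasHom.exists_tensor (P := fun A => A = X.1)
    (finiteSums_of_mem rfl) (hs.decomp_constituents (Y.1 ⊗ Z.1)) h₁
  rw [← hT.cls_tensor k (h'' := hT.exists_tensor k hY hZ hW) hW, ← hT.cls_tensor k h₂]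

instance : Group (hT.GroupOf k) :=
  Group.ofLeftAxioms (hT.mul_assoc_cls k)
    (fun g => by
      obtain ⟨X, hX, rfl⟩ := hT.exists_cls_eq k g
      exact (hT.cls_tensor k ((HasHom.congr (Iso.refl _) (λ_ X.1)).2
        ((simpleSystem k C).hasHom_self X))).symm)
    (fun g => (hT.exists_inv k g).choose_spec)

theorem cls_congr {X X' : SimpleObj C} {h h'} (e : HasHom X'.1 X.1) :
    hT.cls k X h = hT.cls k X' h' := by
  obtain ⟨Y, hY⟩ := h
  exact (hT.cls_eq_iff k).2 ⟨Y, hY, hT.congr k hY e ((simpleSystem k D).hasHom_self Y)⟩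

/-- Choosing representatives embeds the group into the finite set of isomorphism classes of simple
objects of `C`. -/
instance : Finite (hT.GroupOf k) := by
  have := IsFusionCategory.finite_simples (k := k) (C := C)
  choose X h hX using hT.exists_cls_eq k
  refine Finite.of_injective (fun g => SimpleClasses.mk (P := ⊤) (X g).1 (X g).2 trivial) ?_
  intro g g' hg
  obtain ⟨e⟩ := Quotient.exact hg
  rw [← hX g, ← hX g']
  exact hT.cls_congr k (((simpleSystem k C).hasHom_self (X g')).comp_mono
    ((simplesIn ⊤).ι.mapIso e).inv)

/-- The class of a simple object of `D`. -/
def clsRight (Y : SimpleObj D) (h : ∃ X, T X Y) : hT.GroupOf k := hT.cls k _ ⟨Y, h.choose_spec⟩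

/-- Difunctionality makes the chosen partner of `Y` irrelevant. This identifies `T` with equality of
degrees. -/
theorem cls_eq_clsRight_iff {X : SimpleObj C} {Y : SimpleObj D} {h h'} :
    hT.cls k X h = hT.clsRight k Y h' ↔ T X Y := by
  refine (hT.cls_eq_iff k).trans ⟨fun ⟨Y', h₁, h₂⟩ => ?_, fun h => ⟨Y, h, h'.choose_spec⟩⟩
  exact hT.difunctional k h₂ h₁ h'.choose_spec

/-- The subcategory datum of a fusion relation. -/
def datum : SubcategoryDatum.{v₁, v₂, u₁, u₂, t} C D where
  E := supported Subtype.val fun X => ∃ Y, T X Y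
  F := supported Subtype.val fun Y => ∃ X, T X Y
  fusion_E := hT.isFusionSubcategory_left k
  fusion_F := hT.swap.isFusionSubcategory_left k
  -- The group of classes lives in universe `u₁`; being finite, it has a model in the universe `t`
  -- required of a datum.
  G := Shrink.{t} (hT.GroupOf k)
  gradE := Grading.ofDegree
    (fun X hX => Shrink.mulEquiv.symm (hT.cls k X ((hT.mem_left_iff k).1 hX)))
    (fun X Y _ _ ⟨e⟩ => congrArg _ (hT.cls_congr k
      (((simpleSystem k C).hasHom_self X).epi_comp e.inv)))
    (fun X Y Z _ _ _ h => by rw [← map_mul, ← hT.cls_tensor k h])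
  gradF := Grading.ofDegree
    (fun Y hY => Shrink.mulEquiv.symm (hT.clsRight k Y ((hT.swap.mem_left_iff k).1 hY)))
    (fun Y Y' hY _ ⟨e⟩ => congrArg _ ((hT.cls_eq_clsRight_iff k).2
      (hT.congr k ((hT.swap.mem_left_iff k).1 hY).choose_spec ((simpleSystem k C).hasHom_self _)
        (((simpleSystem k D).hasHom_self Y).epi_comp e.inv))))
    (fun Y Y' Y'' hY hY' hY'' h => by
      rw [← map_mul]
      -- Multiplicativity on the right is transported to the left: replace `Y`, `Y'` by partners
      -- `X`, `X'`, and `Y''` by a constituent of `X ⊗ X'`, which is related to it.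
      obtain ⟨X, hX⟩ := (hT.swap.mem_left_iff k).1 hY
      obtain ⟨X', hX'⟩ := (hT.swap.mem_left_iff k).1 hY'
      obtain ⟨X'', hX''⟩ := exists_constituent_tensor k X X'
      rw [← (hT.cls_eq_clsRight_iff k (h := ⟨Y, hX⟩)).2 hX,
        ← (hT.cls_eq_clsRight_iff k (h := ⟨Y', hX'⟩)).2 hX',
        ← (hT.cls_eq_clsRight_iff k (h := ⟨Y'', hT.tensor hX hX' hX'' h⟩)).2 (hT.tensor hX hX' hX'' h),
        ← hT.cls_tensor k hX''])
  faithful_E g := by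
    obtain ⟨X, hX, h⟩ := hT.exists_cls_eq k (Shrink.mulEquiv g)
    refine ⟨SimpleClasses.mk X.1 X.2 ((hT.mem_left_iff k).2 hX), ?_⟩
    exact (MulEquiv.symm_apply_eq _).2 h
  faithful_F g := by
    obtain ⟨X, ⟨Y, hXY⟩, h⟩ := hT.exists_cls_eq k (Shrink.mulEquiv g)
    refine ⟨SimpleClasses.mk Y.1 Y.2 ((hT.swap.mem_left_iff k).2 ⟨X, hXY⟩), ?_⟩
    exact (MulEquiv.symm_apply_eq _).2 (((hT.cls_eq_clsRight_iff k).2 hXY).symm.trans h)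

theorem rel_datum : (datum.{w, v₁, v₂, u₁, u₂, t} k hT).rel = T := by
  funext X Y
  refine propext ⟨?_, fun h => ⟨(hT.mem_left_iff k).2 ⟨Y, h⟩, (hT.swap.mem_left_iff k).2 ⟨X, h⟩, ?_⟩⟩
  · rintro ⟨_, _, h⟩
    exact (hT.cls_eq_clsRight_iff k).1 (Shrink.mulEquiv.symm.injective h)
  · exact congrArg Shrink.mulEquiv.symm ((hT.cls_eq_clsRight_iff k).2 h)

end IsFusionRelation

end Quotient

end Fusion

end

/-! ### The bijection -/

theorem theorem2p2 (k : Type w) [Field k] [IsAlgClosed k] [CharZero k]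
    (C : Type u₁) [Category.{v₁} C] [Abelian C] [Linear k C] [MonoidalCategory C]
    [MonoidalPreadditive C] [MonoidalLinear k C] [RigidCategory C] [Fusion.IsFusionCategory k C]
    (D : Type u₂) [Category.{v₂} D] [Abelian D] [Linear k D] [MonoidalCategory D]
    [MonoidalPreadditive D] [MonoidalLinear k D] [RigidCategory D]
    [Fusion.IsFusionCategory k D] :
    Set.BijOn
      (Fusion.SubcategoryDatum.fiberProductClass k :
        _root_.Quotient (Fusion.SubcategoryDatum.instSetoid.{v₁, v₂, u₁, u₂, t} (C := C) (D := D)) →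
          ObjectProperty (Fusion.DeligneProduct k C D))
      Set.univ
      {S : ObjectProperty (Fusion.DeligneProduct k C D) | Fusion.IsFusionSubcategory S} := by
  refine ⟨?_, ?_, ?_⟩
  · rintro ⟨d⟩ -
    have h := (Fusion.SubcategoryDatum.isFusionRelation_rel k d).isFusionSubcategory_box k
    rw [← Fusion.SubcategoryDatum.fiberProduct_eq_supported k d] at h
    exact h
  · rintro ⟨d⟩ - ⟨d'⟩ - h
    exact Quotient.sound (Fusion.SubcategoryDatum.equivalent_of_rel_eq k
      (Fusion.SubcategoryDatum.rel_eq_of_fiberProduct_eq k h))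
  · intro S hS
    have hT := Fusion.IsFusionSubcategory.isFusionRelation k hS
    refine ⟨Quotient.mk _ (hT.datum k), trivial, ?_⟩
    refine (Fusion.SubcategoryDatum.fiberProduct_eq_supported k (hT.datum k)).trans ?_
    rw [hT.rel_datum k]
    exact (Fusion.simpleSystem_box k C D).supported_eq hS
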